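/- Conventions. In a group, $(a,b)=a^{-1}b^{-1}ab$; Lie commutators are left-normed, $[a,b,c]=[[a,b],c]$; $\gamma_i$ denotes the $i$-th term of the lower central series, $\gamma_1(G)=G$. For a group $G$ and $i\ge 1$ let $\tau_i(G)=\{g\in G: g^n\in\gamma_i(G)\text{ for some integer } n\neq 0\}$, a subgroup of $G$. * $G$ is a *Magnus group* if every $\gamma_i(G)/\gamma_{i+1}(G)$ is torsion-free and $\bigcap_{i\ge1}\gamma_i(G)=\{1\}$. * $G$ is *relatively free* if $G\cong F/W(F)$ for some free group $F$ and some set of laws $W$, where $W(F)$ is the verbal subgroup of $F$ generated by all values of the words of $W$ in $F$. * $L_{\mathbb Q}(G)=\mathbb Q\otimes_{\mathbb Z}\bigoplus_{i\ge1}\tau_i(G)/\tau_{i+1}(G)$, with the Lie bracket determined by $[a\tau_{i+1}(G),b\tau_{j+1}(G)]=(a,b)\tau_{i+j+1}(G)$ for $a\in\tau_i(G)$, $b\in\tau_j(G)$. * Let $\Delta$ be the augmentation ideal of the group algebra $\mathbb QG$, and let $\Gamma^*=\varprojlim_n \mathbb QG/\Delta^n$, regarded as a Lie algebra under $[x,y]=xy-yx$.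 For $g\in G$ put $\log g=\sum_{k\ge1}\frac{(-1)^{k+1}}{k}(g-1)^k\in\Gamma^*$. $\mathcal L_{\mathbb Q}(G)$ denotes the $\mathbb Q$-linear span of $\{\log g: g\in G\}$ in $\Gamma^*$, with the bracket of $\Gamma^*$ whenever it is a Lie subalgebra. Statement. Let $F$ be the free Lie algebra over $\mathbb Q$ on four generators, let $L_{4,3}=F/\gamma_4(F)$ be the free nilpotent Lie algebra of rank $4$ and class $3$, with free generators $x_1,\dots,x_4$, let $I$ be the ideal of $L_{4,3}$ generated by $[x_1,x_2]+[x_3,x_4,x_3]$, let $L=L_{4,3}/I$ and $y_i=x_i+I$. Let $R$ be the group with underlying set $L$ and the Baker–Campbell–Hausdorff multiplication $$x\circ y=x+y+\tfrac12[x,y]+\tfrac1{12}[x,y,y]-\tfrac1{12}[x,y,x],$$ and let $H$ be the subgroup of $R$ generated by $y_1,y_2,y_3,y_4$. Then $H$ is a finitely generated nilpotent Magnus group, $H$ is not relatively free, $\mathcal L_{\mathbb Q}(H)$ is a Lie subalgebra of $\Gamma^*$, and $\mathcal L_{\mathbb Q}(H)\not\cong L_{\mathbb Q}(H)$ as Lie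 algebras over $\mathbb Q$. -/

import Mathlib

namespace MagnusLie

/-! ### Lower central series, isolators -/

/-- `γ_i(G)`, the `i`-th term of the lower central series, with `γ_1(G) = G`. -/
def gamma (G : Type*) [Group G] (i : ℕ+) : Subgroup G :=
  (⊤ : Subgroup G).lowerCentralSeries ((i : ℕ) - 1)

/-- The group commutator `(a, b) = a⁻¹ b⁻¹ a b`. -/
def gcomm {G : Type*} [Group G] (a b : G) : G := a⁻¹ * b⁻¹ * a * b

section aux

open scoped commutatorElement

variable {G : Type*} [Group G]

instance gamma_normal (i : ℕ+) : (gamma G i).Normal := by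
  unfold gamma; infer_instance

lemma gamma_anti {i j : ℕ+} (h : i ≤ j) : gamma G j ≤ gamma G i :=
  Subgroup.lowerCentralSeries_antitone _ (Nat.sub_le_sub_right (by exact_mod_cast h) 1)

lemma gcomm_eq (a b : G) : gcomm a b = ⁅a⁻¹, b⁻¹⁆ := by
  simp [gcomm, commutatorElement_def]

lemma three_subgroups (A B C N : Subgroup G) [N.Normal]
    (h1 : ⁅⁅B, C⁆, A⁆ ≤ N) (h2 : ⁅⁅C, A⁆, B⁆ ≤ N) : ⁅⁅A, B⁆, C⁆ ≤ N := by
  have key : ∀ H : Subgroup G, H.map (QuotientGroup.mk' N) = ⊥ ↔ H ≤ N := by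
    intro H
    rw [Subgroup.map_eq_bot_iff, QuotientGroup.ker_mk']
  rw [← key] at h1 h2 ⊢
  simp only [Subgroup.map_commutator] at h1 h2 ⊢
  exact Subgroup.commutator_commutator_eq_bot_of_rotate h1 h2

lemma lcs_commutator_le (j : ℕ) : ∀ i : ℕ,
    ⁅(⊤ : Subgroup G).lowerCentralSeries i, (⊤ : Subgroup G).lowerCentralSeries j⁆ ≤
      (⊤ : Subgroup G).lowerCentralSeries (i + j + 1) := by
  induction j with
  | zero => intro i; exact le_rfl
  | succ j ih =>
    intro i
    rw [Subgroup.commutator_comm, Subgroup.lowerCentralSeries_succ _ j]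
    refine three_subgroups _ _ _ _ ?_ ?_
    · rw [Subgroup.commutator_comm ⊤]
      refine (ih (i + 1)).trans (le_of_eq ?_)
      congr 1; ring
    · rw [Subgroup.commutator_comm _ ⊤]
      rw [Subgroup.commutator_comm ⊤]
      exact Subgroup.commutator_mono (ih i) le_rfl

/-- The central elements of finite order. -/
def torCenter (Q : Type*) [Group Q] : Subgroup Q where
  carrier := {q | q ∈ Subgroup.center Q ∧ ∃ n : ℕ, n ≠ 0 ∧ q ^ n = 1}
  one_mem' := ⟨one_mem _, 1, one_ne_zero, by simp⟩
  mul_mem' := by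
    rintro a b ⟨ha, n, hn, hna⟩ ⟨hb, m, hm, hmb⟩
    refine ⟨mul_mem ha hb, n * m, mul_ne_zero hn hm, ?_⟩
    have hc : Commute a b := (Subgroup.mem_center_iff.1 hb a)
    rw [hc.mul_pow, pow_mul, hna, mul_comm, pow_mul, hmb]; simp
  inv_mem' := by
    rintro a ⟨ha, n, hn, hna⟩
    exact ⟨inv_mem ha, n, hn, by simp [hna]⟩

lemma comm_pow {a b : G} (h : ⁅a, b⁆ ∈ Subgroup.center G) (n : ℕ) : ⁅a ^ n, b⁆ = ⁅a, b⁆ ^ n := by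
  induction n with
  | zero => simp
  | succ n ih =>
    rw [pow_succ' a, commutatorElement_mul_left_eq_conj_mul, ih]
    have := Subgroup.mem_center_iff.1 (pow_mem h n) a
    rw [this, mul_inv_cancel_right, pow_succ]

lemma comm_pow_right {a b : G} (h : ⁅a, b⁆ ∈ Subgroup.center G) (n : ℕ) :
    ⁅a, b ^ n⁆ = ⁅a, b⁆ ^ n := by
  have h' : ⁅b, a⁆ ∈ Subgroup.center G := by
    rw [← commutatorElement_inv]; exact inv_mem h
  rw [← commutatorElement_inv, comm_pow h', ← inv_pow, commutatorElement_inv]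

lemma mk_center {k : ℕ} {x : G} (hx : x ∈ (⊤ : Subgroup G).lowerCentralSeries k) :
    (QuotientGroup.mk' ((⊤ : Subgroup G).lowerCentralSeries (k + 1)) x) ∈ Subgroup.center _ := by
  rw [Subgroup.mem_center_iff]
  intro y
  obtain ⟨y, rfl⟩ := QuotientGroup.mk'_surjective _ y
  symm
  rw [← commutatorElement_eq_one_iff_mul_comm, ← map_commutatorElement]
  exact (QuotientGroup.eq_one_iff _).2
    (Subgroup.commutator_mem_commutator hx (Subgroup.mem_top y))

lemma climb {k : ℕ}
    (h : ∀ g ∈ (⊤ : Subgroup G).lowerCentralSeries k,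
      ∃ n : ℕ, n ≠ 0 ∧ g ^ n ∈ (⊤ : Subgroup G).lowerCentralSeries (k + 1)) :
    ∀ g ∈ (⊤ : Subgroup G).lowerCentralSeries (k + 1),
      ∃ n : ℕ, n ≠ 0 ∧ g ^ n ∈ (⊤ : Subgroup G).lowerCentralSeries (k + 1 + 1) := by
  set N := (⊤ : Subgroup G).lowerCentralSeries (k + 1 + 1) with hN
  have main : (⊤ : Subgroup G).lowerCentralSeries (k + 1) ≤
      (torCenter (G ⧸ N)).comap (QuotientGroup.mk' N) := by
    rw [Subgroup.lowerCentralSeries_succ, Subgroup.commutator_le]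
    intro x hx y hy
    obtain ⟨n, hn, hxn⟩ := h x hx
    have hc : QuotientGroup.mk' N ⁅x, y⁆ ∈ Subgroup.center _ :=
      mk_center (Subgroup.commutator_mem_commutator hx hy)
    refine ⟨hc, n, hn, ?_⟩
    rw [map_commutatorElement] at hc ⊢
    rw [← comm_pow hc, ← map_pow, ← map_commutatorElement]
    exact (QuotientGroup.eq_one_iff _).2 (Subgroup.commutator_mem_commutator hxn hy)
  intro g hg
  obtain ⟨-, n, hn, h1⟩ := main hg
  refine ⟨n, hn, (QuotientGroup.eq_one_iff _).1 ?_⟩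
  simpa using h1

lemma climb_torsion [Group.IsNilpotent G] {k : ℕ}
    (h : ∀ g ∈ (⊤ : Subgroup G).lowerCentralSeries k,
      ∃ n : ℕ, n ≠ 0 ∧ g ^ n ∈ (⊤ : Subgroup G).lowerCentralSeries (k + 1)) :
    ∀ g ∈ (⊤ : Subgroup G).lowerCentralSeries k, ∃ n : ℕ, n ≠ 0 ∧ g ^ n = 1 := by
  have h1 : ∀ j : ℕ, ∀ g ∈ (⊤ : Subgroup G).lowerCentralSeries (k + j),
      ∃ n : ℕ, n ≠ 0 ∧ g ^ n ∈ (⊤ : Subgroup G).lowerCentralSeries (k + j + 1) := by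
    intro j
    induction j with
    | zero => exact h
    | succ j ih => exact climb ih
  have h2 : ∀ j : ℕ, ∀ g ∈ (⊤ : Subgroup G).lowerCentralSeries k,
      ∃ n : ℕ, n ≠ 0 ∧ g ^ n ∈ (⊤ : Subgroup G).lowerCentralSeries (k + j) := by
    intro j
    induction j with
    | zero => intro g hg; exact ⟨1, one_ne_zero, by simpa using hg⟩
    | succ j ih =>
      intro g hg
      obtain ⟨n, hn, hgn⟩ := ih g hg
      obtain ⟨m, hm, hgm⟩ := h1 j _ hgn
      exact ⟨n * m, mul_ne_zero hn hm, by rw [pow_mul]; exact hgm⟩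
  obtain ⟨c, hc⟩ := (Subgroup.nilpotent_iff_lowerCentralSeries (G := G)).1 inferInstance
  intro g hg
  obtain ⟨n, hn, hgn⟩ := h2 c g hg
  refine ⟨n, hn, ?_⟩
  have := Subgroup.lowerCentralSeries_antitone (⊤ : Subgroup G) (Nat.le_add_left c k) hgn
  rw [hc] at this
  simpa using this

lemma torsion_of_gen [Group.IsNilpotent G] {S : Set G} (hS : Subgroup.closure S = ⊤)
    (h : ∀ s ∈ S, ∃ n : ℕ, n ≠ 0 ∧ s ^ n = 1) (g : G) : ∃ n : ℕ, n ≠ 0 ∧ g ^ n = 1 := by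
  refine climb_torsion (k := 0) ?_ g (Subgroup.mem_top g)
  set N := (⊤ : Subgroup G).lowerCentralSeries (0 + 1) with hN
  have main : (⊤ : Subgroup G) ≤ (torCenter (G ⧸ N)).comap (QuotientGroup.mk' N) := by
    refine hS.ge.trans ?_
    rw [Subgroup.closure_le]
    intro s hs
    obtain ⟨n, hn, hsn⟩ := h s hs
    exact ⟨mk_center (k := 0) (Subgroup.mem_top s), n, hn, by rw [← map_pow, hsn, map_one]⟩
  intro g hg
  obtain ⟨-, n, hn, h1⟩ := main (Subgroup.mem_top g)
  refine ⟨n, hn, (QuotientGroup.eq_one_iff _).1 ?_⟩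
  simpa using h1

lemma torsion_mul [Group.IsNilpotent G] {a b : G} {n m : ℕ} (hn : n ≠ 0) (hm : m ≠ 0)
    (ha : a ^ n = 1) (hb : b ^ m = 1) : ∃ r : ℕ, r ≠ 0 ∧ (a * b) ^ r = 1 := by
  have haK : a ∈ Subgroup.closure ({a, b} : Set G) := Subgroup.subset_closure (by simp)
  have hbK : b ∈ Subgroup.closure ({a, b} : Set G) := Subgroup.subset_closure (by simp)
  obtain ⟨r, hr, h⟩ := torsion_of_gen (G := Subgroup.closure ({a, b} : Set G))
    (S := ((↑) : Subgroup.closure ({a, b} : Set G) → G) ⁻¹' {a, b})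
    Subgroup.closure_closure_coe_preimage (by
      rintro ⟨s, hs⟩ (h | h)
      · have h' : s = a := h
        exact ⟨n, hn, Subtype.ext (by simpa [h'] using ha)⟩
      · have h' : s = b := h
        exact ⟨m, hm, Subtype.ext (by simpa [h'] using hb)⟩) (⟨a, haK⟩ * ⟨b, hbK⟩)
  exact ⟨r, hr, by simpa using congrArg Subtype.val h⟩

/-- In a group all of whose commutators are central, the elements `x` with `⁅x, y⁆` torsion. -/
def torCent (y : G) (hc : ∀ x y : G, ⁅x, y⁆ ∈ Subgroup.center G) : Subgroup G where
  carrier := {x | ⁅x, y⁆ ∈ torCenter G}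
  one_mem' := by simp [one_mem]
  mul_mem' := by
    intro a b ha hb
    have : ⁅a * b, y⁆ = ⁅b, y⁆ * ⁅a, y⁆ := by
      rw [commutatorElement_mul_left_eq_conj_mul,
        Subgroup.mem_center_iff.1 (hc b y) a, mul_inv_cancel_right]
    change ⁅_, y⁆ ∈ torCenter G
    rw [this]
    exact mul_mem hb ha
  inv_mem' := by
    intro a ha
    have : ⁅a⁻¹, y⁆ = ⁅a, y⁆⁻¹ := by
      rw [commutatorElement_inv_left, commutatorElement_inv, mul_assoc,
        ← Subgroup.mem_center_iff.1 (hc y a) a, inv_mul_cancel_left]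
    change ⁅_, y⁆ ∈ torCenter G
    rw [this]
    exact inv_mem ha

lemma comm_torsion_gen [Group.IsNilpotent G] {a b : G}
    (hS : Subgroup.closure ({a, b} : Set G) = ⊤) {n m : ℕ} (hn : n ≠ 0) (hm : m ≠ 0)
    (hab : ⁅a ^ n, b ^ m⁆ = 1) : ∃ r : ℕ, r ≠ 0 ∧ ⁅a, b⁆ ^ r = 1 := by
  have hab1 : ⁅a, b⁆ ∈ (⊤ : Subgroup G).lowerCentralSeries 1 :=
    Subgroup.commutator_mem_commutator (Subgroup.mem_top a) (Subgroup.mem_top b)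
  refine climb_torsion (k := 1) ?_ _ hab1
  set N := (⊤ : Subgroup G).lowerCentralSeries (1 + 1) with hN
  have hc : ∀ x y : G ⧸ N, ⁅x, y⁆ ∈ Subgroup.center (G ⧸ N) := by
    intro x y
    obtain ⟨x, rfl⟩ := QuotientGroup.mk'_surjective _ x
    obtain ⟨y, rfl⟩ := QuotientGroup.mk'_surjective _ y
    rw [← map_commutatorElement]
    exact mk_center (k := 1)
      (Subgroup.commutator_mem_commutator (Subgroup.mem_top x) (Subgroup.mem_top y))
  set f := QuotientGroup.mk' N
  have h0 : ⁅f a, f b⁆ ∈ torCenter (G ⧸ N) := by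
    refine ⟨hc _ _, n * m, mul_ne_zero hn hm, ?_⟩
    rw [pow_mul, ← comm_pow (hc _ _), ← comm_pow_right (hc _ _), ← map_pow, ← map_pow,
      ← map_commutatorElement, hab, map_one]
  have symm' : ∀ x y : G ⧸ N, ⁅x, y⁆ ∈ torCenter (G ⧸ N) → ⁅y, x⁆ ∈ torCenter (G ⧸ N) := by
    intro x y h
    rw [← commutatorElement_inv]; exact inv_mem h
  have ext' : ∀ y : G ⧸ N, ⁅f a, y⁆ ∈ torCenter (G ⧸ N) → ⁅f b, y⁆ ∈ torCenter (G ⧸ N) →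
      ∀ x : G, ⁅f x, y⁆ ∈ torCenter (G ⧸ N) := by
    intro y h1 h2 x
    have : (⊤ : Subgroup G) ≤ (torCent y hc).comap f := by
      refine hS.ge.trans ?_
      rw [Subgroup.closure_le]
      rintro s (rfl | rfl)
      · exact h1
      · exact h2
    exact this (Subgroup.mem_top x)
  have self' : ∀ x : G ⧸ N, ⁅x, x⁆ ∈ torCenter (G ⧸ N) := by
    intro x; rw [commutatorElement_self]; exact one_mem _
  have h1 : ∀ x : G, ⁅f x, f a⁆ ∈ torCenter (G ⧸ N) :=
    ext' _ (self' _) (symm' _ _ h0)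
  have h2 : ∀ x : G, ⁅f x, f b⁆ ∈ torCenter (G ⧸ N) :=
    ext' _ h0 (self' _)
  have h3 : ∀ x y : G, ⁅f x, f y⁆ ∈ torCenter (G ⧸ N) := fun x y =>
    ext' _ (symm' _ _ (h1 y)) (symm' _ _ (h2 y)) x
  have main : (⊤ : Subgroup G).lowerCentralSeries 1 ≤ (torCenter (G ⧸ N)).comap f := by
    rw [Subgroup.lowerCentralSeries_succ, Subgroup.commutator_le]
    intro x _ y _
    rw [Subgroup.mem_comap, map_commutatorElement]
    exact h3 x y
  intro g hg
  obtain ⟨-, n, hn, h1⟩ := main hg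
  refine ⟨n, hn, (QuotientGroup.eq_one_iff _).1 ?_⟩
  simpa [f] using h1

lemma comm_torsion [Group.IsNilpotent G] {a b : G} {n m : ℕ} (hn : n ≠ 0) (hm : m ≠ 0)
    (hab : ⁅a ^ n, b ^ m⁆ = 1) : ∃ r : ℕ, r ≠ 0 ∧ ⁅a, b⁆ ^ r = 1 := by
  have haK : a ∈ Subgroup.closure ({a, b} : Set G) := Subgroup.subset_closure (by simp)
  have hbK : b ∈ Subgroup.closure ({a, b} : Set G) := Subgroup.subset_closure (by simp)
  have hcl : Subgroup.closure ({⟨a, haK⟩, ⟨b, hbK⟩} : Set (Subgroup.closure ({a, b} : Set G))) =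
      ⊤ := by
    rw [← Subgroup.closure_closure_coe_preimage (k := ({a, b} : Set G))]
    congr 1
    ext ⟨x, hx⟩
    simp
  obtain ⟨r, hr, h⟩ := comm_torsion_gen hcl hn hm
    (Subtype.ext (by simpa [commutatorElement_def] using hab))
  exact ⟨r, hr, by simpa [commutatorElement_def] using congrArg Subtype.val h⟩

instance quot_gamma_nilpotent (i : ℕ+) : Group.IsNilpotent (G ⧸ gamma G i) := by
  rw [Subgroup.nilpotent_iff_lowerCentralSeries]
  refine ⟨(i : ℕ) - 1, ?_⟩
  rw [← Subgroup.map_top_of_surjective _ (QuotientGroup.mk'_surjective (gamma G i)),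
    ← Subgroup.map_lowerCentralSeries, Subgroup.map_eq_bot_iff, QuotientGroup.ker_mk']
  exact le_rfl

lemma gamma_pow_iff (i : ℕ+) (g : G) (n : ℕ) :
    g ^ n ∈ gamma G i ↔ (QuotientGroup.mk' (gamma G i) g) ^ n = 1 := by
  rw [← map_pow]
  exact (QuotientGroup.eq_one_iff _).symm

lemma gamma_commutator_le (i j : ℕ+) : ⁅gamma G i, gamma G j⁆ ≤ gamma G (i + j) := by
  refine (lcs_commutator_le _ _).trans (le_of_eq ?_)
  unfold gamma
  congr 1
  have := i.pos; have := j.pos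
  rw [PNat.add_coe]
  omega

end aux

/-- `τ_i(G) = {g ∈ G : g ^ n ∈ γ_i(G) for some n ≠ 0}`, the isolator of `γ_i(G)` in `G`. -/
def tau (G : Type*) [Group G] (i : ℕ+) : Subgroup G where
  carrier := {g | ∃ n : ℕ, n ≠ 0 ∧ g ^ n ∈ gamma G i}
  one_mem' := ⟨1, one_ne_zero, by simp [one_mem]⟩
  mul_mem' := by
    rintro a b ⟨n, hn, ha⟩ ⟨m, hm, hb⟩
    rw [gamma_pow_iff] at ha hb
    obtain ⟨r, hr, h⟩ := torsion_mul hn hm ha hb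
    exact ⟨r, hr, by rw [gamma_pow_iff, map_mul]; exact h⟩
  inv_mem' := by
    rintro a ⟨n, hn, ha⟩
    exact ⟨n, hn, by rw [inv_pow]; exact inv_mem ha⟩

section tau

open scoped commutatorElement

variable {G : Type*} [Group G]

instance tau_normal (i : ℕ+) : (tau G i).Normal where
  conj_mem := by
    rintro a ⟨n, hn, ha⟩ g
    exact ⟨n, hn, by rw [conj_pow]; exact (gamma_normal i).conj_mem _ ha g⟩

lemma tau_anti {i j : ℕ+} (h : i ≤ j) : tau G j ≤ tau G i := by
  rintro a ⟨n, hn, ha⟩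
  exact ⟨n, hn, gamma_anti h ha⟩

lemma gcomm_mem_tau {i j : ℕ+} {a b : G} (ha : a ∈ tau G i) (hb : b ∈ tau G j) :
    gcomm a b ∈ tau G (i + j) := by
  rw [gcomm_eq]
  obtain ⟨n, hn, ha⟩ := inv_mem ha
  obtain ⟨m, hm, hb⟩ := inv_mem hb
  have h := gamma_commutator_le i j (Subgroup.commutator_mem_commutator ha hb)
  have h' := (QuotientGroup.eq_one_iff _).2 h
  change QuotientGroup.mk' (gamma G (i + j)) _ = 1 at h'
  rw [map_commutatorElement, map_pow, map_pow] at h'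
  obtain ⟨r, hr, h⟩ := comm_torsion hn hm h'
  exact ⟨r, hr, by rw [gamma_pow_iff, map_commutatorElement]; exact h⟩

end tau


/-! ### The graded Lie ring `L(G) = ⨁ τ_i(G) / τ_{i+1}(G)` and `L_K(G) = K ⊗ L(G)` -/

section graded

variable {G : Type*} [Group G]

lemma gcomm_mem_tau_of {i j k : ℕ+} {a b : G} (ha : a ∈ tau G i) (hb : b ∈ tau G j)
    (h : k ≤ i + j) : gcomm a b ∈ tau G k :=
  tau_anti h (gcomm_mem_tau ha hb)

lemma gcomm_mul_left (a b c : G) :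
    (gcomm a c * gcomm b c)⁻¹ * gcomm (a * b) c =
      (gcomm b c)⁻¹ * gcomm (gcomm a c) b * ((gcomm b c)⁻¹)⁻¹ := by
  simp only [gcomm]; group

lemma gcomm_mul_right (a b c : G) :
    (gcomm a b * gcomm a c)⁻¹ * gcomm a (b * c) =
      gcomm (gcomm a c) (gcomm a b) * gcomm (gcomm a b) c := by
  simp only [gcomm]; group

lemma hall_witt (a b c : G) :
    b⁻¹ * gcomm (gcomm a b⁻¹) c * b * (c⁻¹ * gcomm (gcomm b c⁻¹) a * c) *
      (a⁻¹ * gcomm (gcomm c a⁻¹) b * a) = 1 := by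
  simp only [gcomm]; group

end graded

section piece

variable (G : Type*) [Group G]

/-- The quotient group `τ_i(G) / τ_{i+1}(G)`, written multiplicatively. -/
def GrQuot (i : ℕ+) : Type _ := tau G i ⧸ (tau G (i + 1)).subgroupOf (tau G i)

instance (i : ℕ+) : Group (GrQuot G i) :=
  inferInstanceAs (Group (tau G i ⧸ (tau G (i + 1)).subgroupOf (tau G i)))

variable {G} in
/-- The coset `a τ_{i+1}(G)` of an element `a` of `τ_i(G)`. -/
def grMk (i : ℕ+) : tau G i →* GrQuot G i :=
  QuotientGroup.mk' ((tau G (i + 1)).subgroupOf (tau G i))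

variable {G}

lemma grMk_surjective (i : ℕ+) : Function.Surjective (grMk (G := G) i) :=
  QuotientGroup.mk'_surjective _

lemma grMk_eq_iff {i : ℕ+} (a b : tau G i) :
    grMk i a = grMk i b ↔ (a : G)⁻¹ * b ∈ tau G (i + 1) := by
  refine QuotientGroup.eq.trans ?_
  rw [Subgroup.mem_subgroupOf]
  simp

instance (i : ℕ+) : CommGroup (GrQuot G i) where
  mul_comm x y := by
    obtain ⟨a, rfl⟩ := grMk_surjective i x
    obtain ⟨b, rfl⟩ := grMk_surjective i y
    rw [← map_mul, ← map_mul, grMk_eq_iff]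
    have h := gcomm_mem_tau_of (k := i + 1) b.2 a.2 (by gcongr; exact one_le (a := i))
    have e : gcomm (b : G) a = ((a * b : tau G i) : G)⁻¹ * ((b * a : tau G i) : G) := by
      simp [gcomm, mul_assoc]
    rwa [← e]

lemma grMk_gcomm_mul_left {i j : ℕ+} {a b c : G} (ha : a ∈ tau G i) (hb : b ∈ tau G i)
    (hc : c ∈ tau G j) :
    grMk (i + j) ⟨gcomm (a * b) c, gcomm_mem_tau (mul_mem ha hb) hc⟩ =
      grMk (i + j) ⟨gcomm a c, gcomm_mem_tau ha hc⟩ *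
        grMk (i + j) ⟨gcomm b c, gcomm_mem_tau hb hc⟩ := by
  symm
  rw [← map_mul, grMk_eq_iff]
  change (gcomm a c * gcomm b c)⁻¹ * gcomm (a * b) c ∈ _
  rw [gcomm_mul_left]
  refine (tau_normal _).conj_mem _ (gcomm_mem_tau_of (gcomm_mem_tau ha hc) hb ?_) _
  gcongr; exact one_le

lemma grMk_gcomm_mul_right {i j : ℕ+} {a b c : G} (ha : a ∈ tau G i) (hb : b ∈ tau G j)
    (hc : c ∈ tau G j) :
    grMk (i + j) ⟨gcomm a (b * c), gcomm_mem_tau ha (mul_mem hb hc)⟩ =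
      grMk (i + j) ⟨gcomm a b, gcomm_mem_tau ha hb⟩ *
        grMk (i + j) ⟨gcomm a c, gcomm_mem_tau ha hc⟩ := by
  symm
  rw [← map_mul, grMk_eq_iff]
  change (gcomm a b * gcomm a c)⁻¹ * gcomm a (b * c) ∈ _
  rw [gcomm_mul_right]
  refine mul_mem (gcomm_mem_tau_of (gcomm_mem_tau ha hc) (gcomm_mem_tau ha hb) ?_)
    (gcomm_mem_tau_of (gcomm_mem_tau ha hb) hc ?_)
  · gcongr; exact one_le
  · gcongr; exact one_le

lemma grMk_eq_one {i : ℕ+} {a : G} (ha : a ∈ tau G i) (h : a ∈ tau G (i + 1)) :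
    grMk i ⟨a, ha⟩ = 1 := by
  rw [← map_one (grMk i)]
  symm
  rw [grMk_eq_iff]
  simpa using h

/-- The map `(a τ_{i+1}(G), b τ_{j+1}(G)) ↦ (a, b) τ_{i+j+1}(G)`. -/
def grComm {i j : ℕ+} : GrQuot G i → GrQuot G j → GrQuot G (i + j) :=
  Quotient.map₂ (fun a b => ⟨gcomm (a : G) b, gcomm_mem_tau a.2 b.2⟩) (by
    rintro ⟨a, ha⟩ ⟨a', ha'⟩ haa ⟨b, hb⟩ ⟨b', hb'⟩ hbb
    have haa : grMk i ⟨a, ha⟩ = grMk i ⟨a', ha'⟩ := Quotient.sound haa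
    have hbb : grMk j ⟨b, hb⟩ = grMk j ⟨b', hb'⟩ := Quotient.sound hbb
    rw [grMk_eq_iff] at haa hbb
    obtain ⟨u, rfl⟩ : ∃ u, a' = a * u := ⟨a⁻¹ * a', by group⟩
    obtain ⟨v, rfl⟩ : ∃ v, b' = b * v := ⟨b⁻¹ * b', by group⟩
    simp only [inv_mul_cancel_left] at haa hbb
    have hu : u ∈ tau G i := tau_anti (PNat.lt_add_right i 1).le haa
    have hv : v ∈ tau G j := tau_anti (PNat.lt_add_right j 1).le hbb
    refine Quotient.exact (?_ : grMk (i + j) ⟨gcomm a b, gcomm_mem_tau ha hb⟩ =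
        grMk (i + j) ⟨gcomm (a * u) (b * v), gcomm_mem_tau ha' hb'⟩)
    rw [grMk_gcomm_mul_left ha hu hb', grMk_gcomm_mul_right ha hb hv,
      grMk_eq_one (gcomm_mem_tau ha hv) (gcomm_mem_tau_of ha hbb (by rw [add_assoc])),
      grMk_eq_one (gcomm_mem_tau hu hb') (gcomm_mem_tau_of haa hb' (by rw [add_right_comm])),
      mul_one, mul_one])

lemma grComm_grMk {i j : ℕ+} (a : tau G i) (b : tau G j) :
    grComm (grMk i a) (grMk j b) = grMk (i + j) ⟨gcomm (a : G) b, gcomm_mem_tau a.2 b.2⟩ := rfl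

lemma grComm_mul_left {i j : ℕ+} (x y : GrQuot G i) (z : GrQuot G j) :
    grComm (x * y) z = grComm x z * grComm y z := by
  obtain ⟨a, rfl⟩ := grMk_surjective i x
  obtain ⟨b, rfl⟩ := grMk_surjective i y
  obtain ⟨c, rfl⟩ := grMk_surjective j z
  exact grMk_gcomm_mul_left a.2 b.2 c.2

lemma grComm_mul_right {i j : ℕ+} (x : GrQuot G i) (y z : GrQuot G j) :
    grComm x (y * z) = grComm x y * grComm x z := by
  obtain ⟨a, rfl⟩ := grMk_surjective i x
  obtain ⟨b, rfl⟩ := grMk_surjective j y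
  obtain ⟨c, rfl⟩ := grMk_surjective j z
  exact grMk_gcomm_mul_right a.2 b.2 c.2

lemma grComm_one_left {i j : ℕ+} (z : GrQuot G j) : grComm (1 : GrQuot G i) z = 1 := by
  simpa using (grComm_mul_left (1 : GrQuot G i) 1 z).symm

lemma grComm_one_right {i j : ℕ+} (z : GrQuot G i) : grComm z (1 : GrQuot G j) = 1 := by
  simpa using (grComm_mul_right z (1 : GrQuot G j) 1).symm

end piece

/-- The abelian group `L_i(G) = τ_i(G) / τ_{i+1}(G)`, written additively. -/
abbrev GrPiece (G : Type*) [Group G] (i : ℕ+) : Type _ := Additive (GrQuot G i)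

/-- The multiplication `L_i(G) × L_j(G) → L_{i+j}(G)` induced by the group commutator. -/
instance grMul (G : Type*) [Group G] : DirectSum.GNonUnitalNonAssocSemiring (GrPiece G) where
  mul x y := Additive.ofMul (grComm x.toMul y.toMul)
  mul_zero x := grComm_one_right x.toMul
  zero_mul y := grComm_one_left y.toMul
  mul_add x y z := grComm_mul_right x.toMul y.toMul z.toMul
  add_mul x y z := grComm_mul_left x.toMul y.toMul z.toMul

/-- `L(G) = ⨁_{i ≥ 1} τ_i(G) / τ_{i+1}(G)`. -/
def GradedLie (G : Type*) [Group G] : Type _ := DirectSum ℕ+ (GrPiece G)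

section lieRing

variable (G : Type*) [Group G]

instance : AddCommGroup (GradedLie G) :=
  inferInstanceAs (AddCommGroup (DirectSum ℕ+ (GrPiece G)))

variable {G}

/-- The element `x τ_{i+1}(G)` of `L_i(G) ⊆ L(G)`, for `x ∈ τ_i(G)`. -/
def GradedLie.homog (i : ℕ+) (x : G) (hx : x ∈ tau G i) : GradedLie G :=
  DirectSum.of (GrPiece G) i (Additive.ofMul (grMk i ⟨x, hx⟩))

/-- The biadditive extension to `L(G)` of `[a τ_{i+1}(G), b τ_{j+1}(G)] = (a, b) τ_{i+j+1}(G)`. -/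
def GradedLie.bracket (x y : GradedLie G) : GradedLie G :=
  HMul.hMul (α := DirectSum ℕ+ (GrPiece G)) (β := DirectSum ℕ+ (GrPiece G)) x y

instance : Bracket (GradedLie G) (GradedLie G) := ⟨GradedLie.bracket⟩

namespace GradedLie

lemma bracket_homog {i j : ℕ+} {x y : G} (hx : x ∈ tau G i) (hy : y ∈ tau G j) :
    ⁅homog i x hx, homog j y hy⁆ = homog (i + j) (gcomm x y) (gcomm_mem_tau hx hy) :=
  DirectSum.of_mul_of (A := GrPiece G) _ _

lemma add_bracket (x y z : GradedLie G) : ⁅x + y, z⁆ = ⁅x, z⁆ + ⁅y, z⁆ :=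
  add_mul (R := DirectSum ℕ+ (GrPiece G)) x y z

lemma bracket_add (x y z : GradedLie G) : ⁅x, y + z⁆ = ⁅x, y⁆ + ⁅x, z⁆ :=
  mul_add (R := DirectSum ℕ+ (GrPiece G)) x y z

lemma zero_bracket (x : GradedLie G) : ⁅(0 : GradedLie G), x⁆ = 0 :=
  zero_mul (M₀ := DirectSum ℕ+ (GrPiece G)) x

lemma bracket_zero (x : GradedLie G) : ⁅x, (0 : GradedLie G)⁆ = 0 :=
  mul_zero (M₀ := DirectSum ℕ+ (GrPiece G)) x

lemma neg_bracket (x y : GradedLie G) : ⁅-x, y⁆ = -⁅x, y⁆ := by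
  rw [eq_neg_iff_add_eq_zero, ← add_bracket, neg_add_cancel, zero_bracket]

lemma bracket_neg (x y : GradedLie G) : ⁅x, -y⁆ = -⁅x, y⁆ := by
  rw [eq_neg_iff_add_eq_zero, ← bracket_add, neg_add_cancel, bracket_zero]

@[elab_as_elim]
lemma ind {P : GradedLie G → Prop} (h0 : P 0)
    (h1 : ∀ (i : ℕ+) (x : G) (hx : x ∈ tau G i), P (homog i x hx))
    (h2 : ∀ x y, P x → P y → P (x + y)) (x : GradedLie G) : P x := by
  refine DirectSum.induction_on (β := GrPiece G) (motive := P) x h0 ?_ h2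
  intro i q
  obtain ⟨⟨a, ha⟩, h⟩ := grMk_surjective i q.toMul
  have := h1 i a ha
  unfold homog at this
  rw [h] at this
  exact this

lemma homog_congr {i j : ℕ+} (h : i = j) {x : G} (hx : x ∈ tau G i) :
    homog i x hx = homog j x (h ▸ hx) := by subst h; rfl

lemma homog_mul {i : ℕ+} {x y : G} (hx : x ∈ tau G i) (hy : y ∈ tau G i) :
    homog i (x * y) (mul_mem hx hy) = homog i x hx + homog i y hy := by
  exact (congrArg (fun q => DirectSum.of (GrPiece G) i (Additive.ofMul q))
    (map_mul (grMk i) ⟨x, hx⟩ ⟨y, hy⟩)).trans (map_add (DirectSum.of (GrPiece G) i) _ _)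

lemma homog_one {i : ℕ+} : homog i (1 : G) (one_mem _) = 0 := by
  have := homog_mul (i := i) (one_mem (tau G i)) (one_mem _)
  simpa using this

lemma homog_inv {i : ℕ+} {x : G} (hx : x ∈ tau G i) :
    homog i x⁻¹ (inv_mem hx) = -homog i x hx := by
  rw [eq_neg_iff_add_eq_zero, ← homog_mul]
  simp [homog_one]

lemma homog_eq {i : ℕ+} {x y : G} (hx : x ∈ tau G i) (hy : y ∈ tau G i)
    (h : x⁻¹ * y ∈ tau G (i + 1)) : homog i x hx = homog i y hy := by
  unfold homog
  rw [(grMk_eq_iff ⟨x, hx⟩ ⟨y, hy⟩).2 h]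

lemma homog_conj {i : ℕ+} {x b : G} (hx : x ∈ tau G i) :
    homog i (b⁻¹ * x * b) (by simpa using (tau_normal i).conj_mem x hx b⁻¹) = homog i x hx := by
  refine (homog_eq _ _ ?_).symm
  have hb : b ∈ tau G 1 := ⟨1, one_ne_zero, Subgroup.mem_top _⟩
  have := gcomm_mem_tau hx hb
  simpa [gcomm, mul_assoc] using this

lemma bracket_self (x : GradedLie G) : ⁅x, x⁆ = 0 := by
  have skew : ∀ x y : GradedLie G, ⁅x, y⁆ + ⁅y, x⁆ = 0 := by
    intro x y
    induction x using ind with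
    | h0 => rw [zero_bracket, bracket_zero, add_zero]
    | h2 x x' hx hx' =>
      rw [add_bracket, bracket_add, add_add_add_comm, hx, hx', add_zero]
    | h1 i a ha =>
      induction y using ind with
      | h0 => rw [zero_bracket, bracket_zero, add_zero]
      | h2 y y' hy hy' =>
        rw [add_bracket, bracket_add, add_add_add_comm, hy, hy', add_zero]
      | h1 j b hb =>
        rw [bracket_homog, bracket_homog, homog_congr (add_comm j i), ← homog_mul,
          ← homog_one (i := i + j)]
        congr 1
        simp only [gcomm]; group
  induction x using ind with
  | h0 => exact zero_bracket 0
  | h1 i a ha =>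
    rw [bracket_homog, ← homog_one (i := i + i)]
    congr 1
    simp only [gcomm]; group
  | h2 x y hx hy =>
    rw [add_bracket, bracket_add, bracket_add, hx, hy, zero_add, add_zero, skew]

lemma skew (x y : GradedLie G) : ⁅x, y⁆ = -⁅y, x⁆ := by
  have h := bracket_self (x + y)
  rw [add_bracket, bracket_add, bracket_add, bracket_self, bracket_self, zero_add, add_zero] at h
  exact eq_neg_of_add_eq_zero_left h

lemma jacobi_homog {i j k : ℕ+} {a b c : G} (ha : a ∈ tau G i) (hb : b ∈ tau G j)
    (hc : c ∈ tau G k) :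
    ⁅⁅homog i a ha, homog j b hb⁆, homog k c hc⁆ + ⁅⁅homog j b hb, homog k c hc⁆, homog i a ha⁆ +
      ⁅⁅homog k c hc, homog i a ha⁆, homog j b hb⁆ = 0 := by
  have e2 : j + k + i = i + j + k := by rw [add_comm, add_assoc]
  have e3 : k + i + j = i + j + k := by rw [add_assoc, add_comm]
  have m1 : gcomm (gcomm a b⁻¹) c ∈ tau G (i + j + k) :=
    gcomm_mem_tau (gcomm_mem_tau ha (inv_mem hb)) hc
  have m2 : gcomm (gcomm b c⁻¹) a ∈ tau G (i + j + k) :=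
    e2 ▸ gcomm_mem_tau (gcomm_mem_tau hb (inv_mem hc)) ha
  have m3 : gcomm (gcomm c a⁻¹) b ∈ tau G (i + j + k) :=
    e3 ▸ gcomm_mem_tau (gcomm_mem_tau hc (inv_mem ha)) hb
  have h1 : ⁅⁅homog i a ha, homog j b hb⁆, homog k c hc⁆ = -homog _ _ m1 := by
    rw [← neg_neg (homog j b hb), ← homog_inv, bracket_neg, neg_bracket, bracket_homog,
      bracket_homog]
  have h2 : ⁅⁅homog j b hb, homog k c hc⁆, homog i a ha⁆ = -homog _ _ m2 := by
    rw [← neg_neg (homog k c hc), ← homog_inv, bracket_neg, neg_bracket, bracket_homog,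
      bracket_homog, homog_congr e2]
  have h3 : ⁅⁅homog k c hc, homog i a ha⁆, homog j b hb⁆ = -homog _ _ m3 := by
    rw [← neg_neg (homog i a ha), ← homog_inv, bracket_neg, neg_bracket, bracket_homog,
      bracket_homog, homog_congr e3]
  rw [h1, h2, h3, ← neg_add, ← neg_add, neg_eq_zero, ← homog_conj (b := b) m1,
    ← homog_conj (b := c) m2, ← homog_conj (b := a) m3, ← homog_mul, ← homog_mul,
    ← homog_one (i := i + j + k)]
  congr 1
  exact hall_witt a b c

lemma jacobi (x y z : GradedLie G) : ⁅⁅x, y⁆, z⁆ + ⁅⁅y, z⁆, x⁆ + ⁅⁅z, x⁆, y⁆ = 0 := by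
  induction x using ind with
  | h0 => simp only [zero_bracket, bracket_zero, add_zero]
  | h2 x x' hx hx' =>
    simp only [add_bracket, bracket_add]
    calc _ = (⁅⁅x, y⁆, z⁆ + ⁅⁅y, z⁆, x⁆ + ⁅⁅z, x⁆, y⁆) +
          (⁅⁅x', y⁆, z⁆ + ⁅⁅y, z⁆, x'⁆ + ⁅⁅z, x'⁆, y⁆) := by abel
      _ = 0 := by rw [hx, hx', add_zero]
  | h1 i a ha =>
    induction y using ind with
    | h0 => simp only [zero_bracket, bracket_zero, add_zero]
    | h2 y y' hy hy' =>
      simp only [add_bracket, bracket_add]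
      generalize homog i a ha = x at *
      calc _ = (⁅⁅x, y⁆, z⁆ + ⁅⁅y, z⁆, x⁆ + ⁅⁅z, x⁆, y⁆) +
            (⁅⁅x, y'⁆, z⁆ + ⁅⁅y', z⁆, x⁆ + ⁅⁅z, x⁆, y'⁆) := by abel
        _ = 0 := by rw [hy, hy', add_zero]
    | h1 j b hb =>
      induction z using ind with
      | h0 => simp only [zero_bracket, bracket_zero, add_zero]
      | h2 z z' hz hz' =>
        simp only [add_bracket, bracket_add]
        generalize homog i a ha = x at *
        generalize homog j b hb = y at *
        calc _ = (⁅⁅x, y⁆, z⁆ + ⁅⁅y, z⁆, x⁆ + ⁅⁅z, x⁆, y⁆) +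
              (⁅⁅x, y⁆, z'⁆ + ⁅⁅y, z'⁆, x⁆ + ⁅⁅z', x⁆, y⁆) := by abel
          _ = 0 := by rw [hz, hz', add_zero]
      | h1 k c hc => exact jacobi_homog ha hb hc

end GradedLie

/-- The Lie ring structure of `L(G)`. -/
instance : LieRing (GradedLie G) where
  add_lie := GradedLie.add_bracket
  lie_add := GradedLie.bracket_add
  lie_self := GradedLie.bracket_self
  leibniz_lie x y z := by
    have h := GradedLie.jacobi x y z
    rw [GradedLie.skew ⁅y, z⁆ x, GradedLie.skew ⁅z, x⁆ y, GradedLie.skew z x,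
      GradedLie.bracket_neg, neg_neg] at h
    rw [← sub_eq_zero, ← neg_eq_zero, ← h]
    abel

end lieRing

/-- `L_K(G) = K ⊗_ℤ L(G)`, a Lie algebra over `K`. -/
abbrev GradedLieAlgebra (K : Type*) [CommRing K] (G : Type*) [Group G] : Type _ :=
  TensorProduct ℤ K (GradedLie G)


/-! ### The completed group algebra and `𝓛_K(G)` -/

section completion

variable (K : Type*) [Field K] (G : Type*) [Group G]

/-- The augmentation ideal `Δ` of the group algebra `KG`. -/
noncomputable def augIdeal : Ideal (MonoidAlgebra K G) :=
  RingHom.ker (MonoidAlgebra.lift K K G (1 : G →* K))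

instance : (augIdeal K G).IsTwoSided := by
  unfold augIdeal; infer_instance

/-- The completion `Γ* = lim KG / Δ^n` of the group algebra `KG` in the `Δ`-adic topology:
the compatible sequences in `∏_n KG / Δ^n`. -/
noncomputable def completion : Subalgebra K (∀ n : ℕ, MonoidAlgebra K G ⧸ (augIdeal K G) ^ n) where
  carrier := {x | ∀ (m n : ℕ) (h : m ≤ n), Ideal.Quotient.factor (Ideal.pow_le_pow_right h) (x n) =
    x m}
  mul_mem' hx hy m n h := by simp [hx m n h, hy m n h]
  add_mem' hx hy m n h := by simp [hx m n h, hy m n h]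
  algebraMap_mem' r m n h := rfl

/-- The Lie algebra structure `[x, y] = x y - y x` on `Γ*`. -/
noncomputable instance : LieRing (completion K G) := LieRing.ofAssociativeRing

noncomputable instance : LieAlgebra K (completion K G) := LieAlgebra.ofAssociativeAlgebra

variable {G} in
/-- The truncation `∑_{1 ≤ k < n} (-1)^(k+1) (g - 1)^k / k` of `log g`. -/
noncomputable def logTrunc (g : G) (n : ℕ) : MonoidAlgebra K G :=
  ∑ k ∈ Finset.Ico 1 n, ((-1) ^ (k + 1) / (k : K)) • (MonoidAlgebra.of K G g - 1) ^ k

variable {G} in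
/-- `log g = ∑_{k ≥ 1} (-1)^(k+1) (g - 1)^k / k` in `Γ*`, for `g ∈ G`. -/
noncomputable def groupLog (g : G) : completion K G :=
  ⟨fun n => Ideal.Quotient.mk _ (logTrunc K g n), by
    intro m n h
    rw [Ideal.Quotient.factor_mk, Ideal.Quotient.eq]
    rcases Nat.eq_zero_or_pos m with rfl | hm
    · rw [Submodule.pow_zero, Ideal.one_eq_top]; exact Submodule.mem_top
    rw [logTrunc, logTrunc, ← Finset.sum_Ico_consecutive _ hm h, add_sub_cancel_left]
    refine Ideal.sum_mem _ fun k hk => Submodule.smul_of_tower_mem _ _ ?_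
    refine Ideal.pow_le_pow_right (Finset.mem_Ico.1 hk).1 (Ideal.pow_mem_pow ?_ k)
    simp [augIdeal, RingHom.mem_ker]⟩

/-- The `K`-subspace of `Γ*` spanned by all `log g`, `g ∈ G`. -/
noncomputable def logSpan : Submodule K (completion K G) :=
  Submodule.span K (Set.range (groupLog K (G := G)))

end completion

/-! ### Magnus groups and relatively free groups -/

/-- A Magnus group: every `γ_i(G) / γ_{i+1}(G)` is torsion-free and `⋂ γ_i(G) = 1`. -/
def IsMagnus (G : Type*) [Group G] : Prop :=
  (∀ (i : ℕ+) (q : gamma G i ⧸ (gamma G (i + 1)).subgroupOf (gamma G i)) (n : ℕ),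
    n ≠ 0 → q ^ n = 1 → q = 1) ∧
  ⨅ i : ℕ+, gamma G i = ⊥

/-- The verbal subgroup `W(G)`, generated by all values in `G` of the words in `W`. -/
def verbalSubgroup (W : Set (FreeGroup ℕ)) (G : Type*) [Group G] : Subgroup G :=
  Subgroup.closure {g | ∃ w ∈ W, ∃ φ : FreeGroup ℕ →* G, φ w = g}

instance (W : Set (FreeGroup ℕ)) (G : Type*) [Group G] : (verbalSubgroup W G).Normal where
  conj_mem := by
    intro n hn g
    have h : verbalSubgroup W G ≤ (verbalSubgroup W G).comap (MulAut.conj g).toMonoidHom := by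
      refine (Subgroup.closure_le _).2 ?_
      rintro _ ⟨w, hw, φ, rfl⟩
      exact Subgroup.subset_closure ⟨w, hw, (MulAut.conj g).toMonoidHom.comp φ, rfl⟩
    exact h hn

/-- `G` is relatively free: it is isomorphic to `F / W(F)` for a free group `F` (of any rank) and
the variety of groups defined by some set of laws `W`. -/
def IsRelativelyFree.{u} (G : Type u) [Group G] : Prop :=
  ∃ (X : Type u) (W : Set (FreeGroup ℕ)),
    Nonempty (G ≃* FreeGroup X ⧸ verbalSubgroup W (FreeGroup X))

/-! ### The group structure on a Lie algebra of class at most 3 -/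

section BCH

variable {M : Type*} [LieRing M] [LieAlgebra ℚ M]

/-- The Baker-Campbell-Hausdorff product on a Lie algebra of class at most 3:
`x ∘ y = x + y + [x, y]/2 + [x, y, y]/12 - [x, y, x]/12`. -/
def bch (x y : M) : M :=
  x + y + (1 / 2 : ℚ) • ⁅x, y⁆ + (1 / 12 : ℚ) • ⁅⁅x, y⁆, y⁆ - (1 / 12 : ℚ) • ⁅⁅x, y⁆, x⁆

lemma bch_assoc (h : ∀ a b c d : M, ⁅⁅⁅a, b⁆, c⁆, d⁆ = 0) (x y z : M) :
    bch (bch x y) z = bch x (bch y z) := by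
  have h' : ∀ a b c d : M, ⁅d, ⁅⁅a, b⁆, c⁆⁆ = 0 := fun a b c d => by
    rw [← lie_skew, h, neg_zero]
  have h'' : ∀ a b c d : M, ⁅⁅a, b⁆, ⁅c, d⁆⁆ = 0 := fun a b c d => by
    rw [leibniz_lie, h, ← lie_skew c, h, neg_zero, add_zero]
  simp only [bch, add_lie, lie_add, sub_lie, lie_sub, smul_lie, lie_smul, h, h', h'',
    smul_zero, add_zero, sub_zero]
  have s3 : ∀ a b c : M, ⁅a, ⁅b, c⁆⁆ = -⁅⁅b, c⁆, a⁆ := fun a b c => (lie_skew a ⁅b, c⁆).symm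
  have e2 : ⁅z, x⁆ = -⁅x, z⁆ := (lie_skew z x).symm
  have jac : ⁅⁅x, z⁆, y⁆ = ⁅⁅x, y⁆, z⁆ + ⁅⁅y, z⁆, x⁆ := by
    have := lie_jacobi x y z
    rw [s3, s3, s3, e2, neg_lie, neg_neg] at this
    rw [← sub_eq_zero, ← this]; abel
  simp only [s3, jac, neg_lie, h, neg_zero, smul_zero, add_zero]
  module

lemma bch_zero (x : M) : bch x 0 = x := by simp [bch]

lemma zero_bch (x : M) : bch 0 x = x := by simp [bch]

lemma neg_bch (x : M) : bch (-x) x = 0 := by simp [bch]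

end BCH

/-! ### The example -/

/-- The free Lie algebra of rank 4 over `ℚ`. -/
abbrev FreeLie4 : Type := FreeLieAlgebra ℚ (Fin 4)

/-- `L_{4,3} = F / γ_4(F)`, the free nilpotent Lie algebra of rank 4 and class 3 (in Mathlib's
indexing the lower central series starts with the term of index 0). -/
abbrev FreeNilp : Type := FreeLie4 ⧸ LieModule.lowerCentralSeries ℚ FreeLie4 FreeLie4 3

/-- The free generator `x_{i+1}` of `L_{4,3}`. -/
noncomputable def genX (i : Fin 4) : FreeNilp := LieSubmodule.Quotient.mk (FreeLieAlgebra.of ℚ i)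

/-- `v = [x_1, x_2] + [x_3, x_4, x_3]`. -/
noncomputable def relator : FreeNilp := ⁅genX 0, genX 1⁆ + ⁅⁅genX 2, genX 3⁆, genX 2⁆

/-- The Lie algebra `L = L_{4,3} / I`, with `I` the ideal generated by `v`. -/
abbrev ExampleLie : Type := FreeNilp ⧸ LieSubmodule.lieSpan ℚ FreeNilp {relator}

/-- The image `y_{i+1}` of `x_{i+1}` in `L`. -/
noncomputable def genY (i : Fin 4) : ExampleLie := LieSubmodule.Quotient.mk (genX i)

lemma exampleLie_class (a b c d : ExampleLie) : ⁅⁅⁅a, b⁆, c⁆, d⁆ = 0 := by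
  have key : ∀ a b c d : FreeLie4,
      ⁅⁅⁅a, b⁆, c⁆, d⁆ ∈ LieModule.lowerCentralSeries ℚ FreeLie4 FreeLie4 3 := by
    intro a b c d
    have e : ⁅⁅⁅a, b⁆, c⁆, d⁆ = -⁅d, ⁅c, ⁅b, a⁆⁆⁆ := by
      rw [← lie_skew ⁅⁅a, b⁆, c⁆ d, ← lie_skew ⁅a, b⁆ c, ← lie_skew a b]
      simp only [lie_neg, neg_neg]
    rw [e, neg_mem_iff]
    simp only [LieModule.lowerCentralSeries_succ]
    exact LieSubmodule.lie_mem_lie (LieSubmodule.mem_top d)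
      (LieSubmodule.lie_mem_lie (LieSubmodule.mem_top c)
        (LieSubmodule.lie_mem_lie (LieSubmodule.mem_top b) (LieSubmodule.mem_top a)))
  have surj : ∀ a : ExampleLie, ∃ a' : FreeLie4,
      a = LieSubmodule.Quotient.mk (LieSubmodule.Quotient.mk a' : FreeNilp) := by
    intro a
    obtain ⟨a, rfl⟩ := LieSubmodule.Quotient.surjective_mk' _ a
    obtain ⟨a, rfl⟩ := LieSubmodule.Quotient.surjective_mk' _ a
    exact ⟨a, rfl⟩
  obtain ⟨a, rfl⟩ := surj a
  obtain ⟨b, rfl⟩ := surj b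
  obtain ⟨c, rfl⟩ := surj c
  obtain ⟨d, rfl⟩ := surj d
  simp only [← LieSubmodule.Quotient.mk_bracket]
  rw [(LieSubmodule.Quotient.mk_eq_zero' (N := LieModule.lowerCentralSeries ℚ FreeLie4 FreeLie4 3)).2
    (key a b c d)]
  rfl

/-- The group `R`: the set `L` with the Baker-Campbell-Hausdorff product. -/
def ExampleGroup : Type := ExampleLie

/-- The underlying element of `L`. -/
def ExampleGroup.toLie (x : ExampleGroup) : ExampleLie := x

/-- An element of `L`, as an element of `R`. -/
def ExampleGroup.ofLie (x : ExampleLie) : ExampleGroup := x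

open ExampleGroup in
noncomputable instance : Group ExampleGroup where
  mul x y := ofLie (bch x.toLie y.toLie)
  one := ofLie 0
  inv x := ofLie (-x.toLie)
  mul_assoc x y z := bch_assoc exampleLie_class x.toLie y.toLie z.toLie
  one_mul x := zero_bch x.toLie
  mul_one x := bch_zero x.toLie
  inv_mul_cancel x := neg_bch x.toLie

/-- The subgroup `H` of `R` generated by `y_1, y_2, y_3, y_4`. -/
noncomputable def exampleH : Subgroup ExampleGroup := 
  Subgroup.closure (Set.range fun i => ExampleGroup.ofLie (genY i))

end MagnusLie

/-! The commutator of $y_1$ and $y_2$ in $H$ is the inverse of that of $(y_3,y_4)$ with $y_3$, hence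
lies in $\gamma_3(H)$. The graded algebra $L_{\mathbb Q}(H)$ forgets the filtration: there the
classes of $y_1$ and $y_2$ commute (`gradedGen_lie`), although they are independent modulo brackets.
In $\mathcal L_{\mathbb Q}(H)$ this cannot happen: commuting elements have proportional images
modulo brackets (`coord_minor_eq_zero`, and in isomorphism-invariant form
`functional_minor_eq_zero`).

For the proportionality, let $[u,v]=0$. Strictly upper triangular $3\times3$ representations of $L$
show that every $2\times2$ minor of the coordinates of $u,v$ vanishes, except possibly the minor $P$
of the coordinates $1,2$. A five-dimensional representation in which $[y_1,y_2]\ne0$ (`exists_five`)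
writes $P$ as a combination of the third and fourth coordinates of $u$ and $v$. The determinantal
relations between minors make $P$ times each of those coordinates zero, so $P^2=0$.

Two tools connect $L$ with $\Gamma^*$. First, $\log g$ is the linear coefficient of the polynomial
sequence $n\mapsto g^n$, so comparing linear coefficients in the collection formula and in
$h^{-n}gh^n$ gives $\log(gh)$ and $[\log g,\log h]$ as combinations of logarithms (`IsLog.mul_eq`,
`IsLog.lie_eq`); thus $\mathcal L_{\mathbb Q}(H)$ is a Lie subalgebra. Second, a representation
$\rho$ of $L$ by matrices raising weights below four exponentiates to $R$ and extends to $\Gamma^*$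
with $\log g\mapsto\rho(g)$ (`exists_completion_representation`).

The same small representations provide functionals dual to generators of the lower central factors
of $H$, which are therefore torsion-free (`mem_of_pow_mem`). If $H$ were relatively free, some
endomorphism would carry the first two coordinates to the last two, and the commutator of $y_3,y_4$
would vanish modulo $\gamma_3$, which it does not. -/

namespace MagnusLie

/-! ### Polynomial sequences in a noncommutative algebra and their linear coefficients. -/

section LinearCoeff

open Polynomial

variable {A : Type*} [Ring A]

/-- The sequence `s` is polynomial, with constant coefficient `c` and linear coefficient `d`. -/
def HasLinearCoeff (s : ℕ → A) (c d : A) : Prop :=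
  ∃ P : A[X], (∀ n : ℕ, P.eval (n : A) = s n) ∧ P.coeff 0 = c ∧ P.coeff 1 = d

namespace HasLinearCoeff

variable {s t : ℕ → A} {c d c' d' : A}

lemma const (c : A) : HasLinearCoeff (fun _ => c) c 0 :=
  ⟨C c, by simp, by simp, by simp⟩

lemma congr (h : HasLinearCoeff s c d) (hs : ∀ n, s n = t n) (hd : d = d') :
    HasLinearCoeff t c d' := by
  obtain rfl : s = t := funext hs
  exact hd ▸ h

lemma add (h : HasLinearCoeff s c d) (h' : HasLinearCoeff t c' d') :
    HasLinearCoeff (fun n => s n + t n) (c + c') (d + d') := by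
  obtain ⟨P, h1, h2, h3⟩ := h
  obtain ⟨Q, h1', h2', h3'⟩ := h'
  exact ⟨P + Q, by simp [h1, h1'], by simp [h2, h2'], by simp [h3, h3']⟩

lemma mul (h : HasLinearCoeff s c d) (h' : HasLinearCoeff t c' d') :
    HasLinearCoeff (fun n => s n * t n) (c * c') (c * d' + d * c') := by
  obtain ⟨P, h1, h2, h3⟩ := h
  obtain ⟨Q, h1', h2', h3'⟩ := h'
  refine ⟨P * Q, fun n => ?_, by simp [h2, h2'], by rw [mul_coeff_one, h2, h2', h3, h3']⟩
  change _ = s n * t n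
  -- Evaluation at a natural number is multiplicative although `A` is not commutative, since natural
  -- numbers are central.
  rw [← h1, ← h1']
  exact eval₂_mul_noncomm _ _ fun k => (Nat.commute_cast _ n)

variable [Algebra ℚ A]

lemma eval_smul (q : ℚ[X]) (y : A) :
    HasLinearCoeff (fun n => q.eval (n : ℚ) • y) (q.coeff 0 • y) (q.coeff 1 • y) := by
  refine ⟨q.map (algebraMap ℚ A) * C y, fun n => ?_, ?_, ?_⟩
  · change _ = q.eval (n : ℚ) • y
    rw [eval_mul_C_of_commute (Nat.cast_commute n _).symm, Algebra.smul_def]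
    congr 1
    have : (n : A) = algebraMap ℚ A (n : ℚ) := by simp
    rw [this, eval_map_algebraMap, aeval_algebraMap_apply, coe_aeval_eq_eval]
  · rw [coeff_mul_C, coeff_map, Algebra.smul_def]
  · rw [coeff_mul_C, coeff_map, Algebra.smul_def]

/-- Root counting is unavailable over `A`. A rational functional applied to the coefficients of the
difference gives a polynomial over `ℚ` vanishing at all natural numbers, hence zero; such
functionals separate points of `A`. -/
lemma unique (h : HasLinearCoeff s c d) (h' : HasLinearCoeff s c' d') : d = d' := by
  obtain ⟨P, h1, h2, h3⟩ := h
  obtain ⟨Q, h1', h2', h3'⟩ := h'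
  suffices P = Q by rw [← h3, ← h3', this]
  ext k
  rw [← sub_eq_zero, ← Module.forall_dual_apply_eq_zero_iff ℚ]
  intro f
  set N := max P.natDegree Q.natDegree + 1
  have hP : P.natDegree < N := by omega
  have hQ : Q.natDegree < N := by omega
  set T : ℚ[X] := ∑ i ∈ Finset.range N, C (f (P.coeff i - Q.coeff i)) * X ^ i with hT
  have hT0 : T = 0 := by
    refine eq_zero_of_infinite_isRoot T (Set.infinite_of_injective_forall_mem
      (f := fun n : ℕ => (n : ℚ)) Nat.cast_injective fun n => ?_)
    have h := (h1 n).trans (h1' n).symm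
    rw [eval_eq_sum_range' hP, eval_eq_sum_range' hQ, ← sub_eq_zero, ← Finset.sum_sub_distrib] at h
    have h' := congrArg f h
    rw [map_sum, map_zero] at h'
    simp only [Set.mem_ofPred_eq, IsRoot.def, hT, eval_finsetSum, eval_mul, eval_C, eval_pow, eval_X]
    rw [← h']
    refine Finset.sum_congr rfl fun i _ => ?_
    have e : ∀ x : A, x * (n : A) ^ i = ((n : ℚ) ^ i) • x := by
      intro x
      rw [← Nat.cast_pow, ← Nat.cast_pow, Nat.cast_smul_eq_nsmul, nsmul_eq_mul, Nat.cast_comm]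
    rw [e, e, ← smul_sub, map_smul, smul_eq_mul, mul_comm]
  by_cases hk : k < N
  · have := congrArg (fun p => coeff p k) hT0
    simpa [hT, finsetSum_coeff, coeff_C_mul, coeff_X_pow, hk, -map_sub] using this
  · rw [coeff_eq_zero_of_natDegree_lt (by omega), coeff_eq_zero_of_natDegree_lt (by omega)]
    simp

end HasLinearCoeff

/-- The polynomial `X (X - 1) ⋯ (X - k + 1) / k!`. -/
noncomputable def choosePoly : ℕ → ℚ[X]
  | 0 => 1
  | k + 1 => C (1 / (k + 1 : ℚ)) * (choosePoly k * (X - C (k : ℚ)))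

lemma choosePoly_eval (n k : ℕ) : (choosePoly k).eval (n : ℚ) = n.choose k := by
  induction k with
  | zero => simp [choosePoly]
  | succ k ih =>
    have h : (k + 1 : ℚ) ≠ 0 := by positivity
    have h2 : (n.choose (k + 1) : ℚ) * (k + 1) = n.choose k * (n - k) := by
      rcases le_or_gt k n with hk | hk
      · have := Nat.choose_succ_right_eq n k
        rw [← Nat.cast_sub hk]
        exact_mod_cast this
      · rw [Nat.choose_eq_zero_of_lt hk, Nat.choose_eq_zero_of_lt (by omega)]; simp
    simp only [choosePoly, eval_mul, eval_C, ih, eval_sub, eval_X]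
    rw [← h2]; field_simp

lemma choosePoly_coeff_zero (k : ℕ) : (choosePoly (k + 1)).coeff 0 = 0 := by
  rw [coeff_zero_eq_eval_zero]
  have := choosePoly_eval 0 (k + 1)
  simpa using this

/-- These are the coefficients of the logarithmic series, which is why the linear coefficient of `z
^ n` is `log z`. -/
lemma choosePoly_coeff_one (k : ℕ) : (choosePoly (k + 1)).coeff 1 = (-1) ^ k / (k + 1 : ℚ) := by
  induction k with
  | zero => simp [choosePoly]
  | succ k ih =>
    have h : (k + 1 : ℚ) ≠ 0 := by positivity
    have h' : (k + 1 + 1 : ℚ) ≠ 0 := by positivity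
    rw [choosePoly, coeff_C_mul, mul_coeff_one, choosePoly_coeff_zero, ih]
    simp only [coeff_sub, coeff_X_zero, coeff_C_zero]
    push_cast
    field_simp
    ring

variable [Algebra ℚ A]

/-- If `(z - 1) ^ N = 0`, then `z ^ q(n)` is polynomial in `n`, with linear coefficient
`q'(0) log z`. -/
lemma hasLinearCoeff_pow {z : A} {N : ℕ} (hz : (z - 1) ^ N = 0) {m : ℕ → ℕ} {q : ℚ[X]}
    (hq : ∀ n : ℕ, q.eval (n : ℚ) = m n) (hm : m 0 = 0) :
    HasLinearCoeff (fun n => z ^ m n) 1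
      (q.coeff 1 • ∑ k ∈ Finset.Ico 1 N, ((-1) ^ (k + 1) / (k : ℚ)) • (z - 1) ^ k) := by
  have hq0 : q.coeff 0 = 0 := by
    rw [coeff_zero_eq_eval_zero]; simpa [hm] using hq 0
  have c0 : ∀ k, ((choosePoly k).comp q).coeff 0 = (choosePoly k).coeff 0 := by
    intro k
    rw [coeff_zero_eq_eval_zero, eval_comp, ← coeff_zero_eq_eval_zero q, hq0,
      coeff_zero_eq_eval_zero]
  -- Chain rule at 0, where `q` vanishes.
  have c1 : ∀ k, ((choosePoly k).comp q).coeff 1 = q.coeff 1 * (choosePoly k).coeff 1 := by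
    have e : ∀ p : ℚ[X], p.coeff 1 = p.derivative.eval 0 := by
      intro p
      rw [← coeff_zero_eq_eval_zero, coeff_derivative]; simp
    intro k
    rw [e, derivative_comp, eval_mul, eval_comp, ← coeff_zero_eq_eval_zero q, hq0, ← e, ← e]
  rcases Nat.eq_zero_or_pos N with rfl | hN
  · rw [pow_zero] at hz
    have : Subsingleton A := subsingleton_of_zero_eq_one hz.symm
    exact ⟨0, fun _ => Subsingleton.elim _ _, Subsingleton.elim _ _, Subsingleton.elim _ _⟩
  refine ⟨∑ k ∈ Finset.range N, ((choosePoly k).comp q).map (algebraMap ℚ A) * C ((z - 1) ^ k),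
    fun n => ?_, ?_, ?_⟩
  · have h1 : z ^ m n = ∑ k ∈ Finset.range N, ((m n).choose k : A) * (z - 1) ^ k := by
      -- The binomial expansion of `z = (z - 1) + 1` may be continued past `m n`, where the
      -- coefficients are zero. Taken up to `N + m n + 1`, it can then be cut at `N` by nilpotency,
      -- giving a range independent of `n`.
      have h2 : ∀ M, ∑ k ∈ Finset.range (m n + 1 + M), ((m n).choose k : A) * (z - 1) ^ k
          = z ^ m n := by
        intro M
        have h3 := (Commute.one_right (z - 1)).add_pow (m n)
        rw [sub_add_cancel] at h3
        rw [h3, Finset.sum_range_add, Finset.sum_eq_zero (s := Finset.range M), add_zero]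
        · refine Finset.sum_congr rfl fun k _ => ?_
          rw [one_pow, mul_one, Nat.cast_comm]
        · intro k _
          rw [Nat.choose_eq_zero_of_lt (by omega)]; simp
      rw [← h2 N, show m n + 1 + N = N + (m n + 1) by ring, Finset.sum_range_add,
        Finset.sum_eq_zero (s := Finset.range (m n + 1)), add_zero]
      intro k _
      rw [pow_add, hz]; simp
    change _ = z ^ m n
    rw [h1, eval_finsetSum]
    refine Finset.sum_congr rfl fun k _ => ?_
    rw [eval_mul_C_of_commute (Nat.cast_commute n _).symm]
    congr 1
    have : (n : A) = algebraMap ℚ A (n : ℚ) := by simp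
    rw [this, eval_map_algebraMap, aeval_algebraMap_apply, coe_aeval_eq_eval, eval_comp, hq,
      choosePoly_eval]
    simp
  · rw [finsetSum_coeff, ← Finset.sum_subset (Finset.singleton_subset_iff.2
      (Finset.mem_range.2 hN))]
    · simp [choosePoly]
    · intro k _ hk
      obtain ⟨k, rfl⟩ := Nat.exists_eq_succ_of_ne_zero (by simpa using hk)
      simp [c0, choosePoly_coeff_zero]
  · rw [finsetSum_coeff, Finset.range_eq_Ico, Finset.sum_eq_sum_Ico_succ_bot hN, Finset.smul_sum]
    have : (((choosePoly 0).comp q).map (algebraMap ℚ A) * C ((z - 1) ^ 0)).coeff 1 = 0 := by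
      simp [choosePoly, coeff_one]
    rw [this, zero_add]
    refine Finset.sum_congr rfl fun k hk => ?_
    have hk0 : k ≠ 0 := by have := Finset.mem_Ico.1 hk; omega
    obtain ⟨k, rfl⟩ := Nat.exists_eq_succ_of_ne_zero hk0
    rw [coeff_mul_C, coeff_map, c1, Nat.succ_eq_add_one, choosePoly_coeff_one, smul_smul, Algebra.smul_def]
    congr 2
    push_cast
    ring

end LinearCoeff
end MagnusLie

namespace MagnusLie

/-! ### Collection formulas in groups of class three. -/

section ClassThree

variable {H : Type*} [Group H]

lemma pow_mul_comm_of_commute {x y z : H} (h : x * y = y * x * z) (hz : Commute z x) (n : ℕ) :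
    x ^ n * y = y * x ^ n * z ^ n := by
  induction n with
  | zero => simp
  | succ n ih =>
    rw [pow_succ x, mul_assoc, h, mul_assoc y, ← mul_assoc (x ^ n) y, ih, pow_succ z]
    simp only [mul_assoc]
    rw [← mul_assoc (z ^ n) x, (hz.pow_left n).eq, mul_assoc]

lemma mul_pow_comm_of_commute {x y z : H} (h : x * y = y * x * z) (hz : Commute z y) (n : ℕ) :
    x * y ^ n = y ^ n * x * z ^ n := by
  induction n with
  | zero => simp
  | succ n ih =>
    rw [pow_succ y, ← mul_assoc, ih, mul_assoc, (hz.pow_left n).eq, pow_succ' z]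
    simp only [mul_assoc]
    rw [← mul_assoc x y, h]
    simp only [mul_assoc]

/-- Each time `g` crosses an `h` a factor `c` appears, which has still to cross the powers of `h` on
its right and leaves a `q` for each; the total is a triangular number. -/
lemma pow_mul_eq {g h c q : H} (hgh : h * g = g * h * c) (hch : c * h = h * c * q)
    (hq : ∀ x, q * x = x * q) (n : ℕ) :
    h ^ n * g = g * h ^ n * c ^ n * q ^ n.choose 2 := by
  induction n with
  | zero => simp
  | succ n ih =>
    have hqk : ∀ (k : ℕ) x, q ^ k * x = x * q ^ k := fun k x => (Commute.pow_left (hq x) k).eq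
    calc h ^ (n + 1) * g = h * (h ^ n * g) := by rw [pow_succ', mul_assoc]
      _ = (h * g) * h ^ n * c ^ n * q ^ n.choose 2 := by rw [ih]; simp only [mul_assoc]
      _ = g * h * (c * h ^ n) * c ^ n * q ^ n.choose 2 := by rw [hgh]; simp only [mul_assoc]
      _ = g * h * h ^ n * c * (q ^ n * c ^ n) * q ^ n.choose 2 := by
        rw [mul_pow_comm_of_commute hch (hq h)]; simp only [mul_assoc]
      _ = _ := by
        rw [hqk, pow_succ' h, pow_succ' c, Nat.choose_succ_succ' n 1, Nat.choose_one_right, pow_add]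
        simp only [mul_assoc]

/-- The collection formula in a group of class three. -/
lemma mul_pow_eq {g h c p q : H} (hgh : h * g = g * h * c) (hcg : c * g = g * c * p)
    (hch : c * h = h * c * q) (hp : ∀ x, p * x = x * p) (hq : ∀ x, q * x = x * q) (n : ℕ) :
    (g * h) ^ n = g ^ n * h ^ n * c ^ n.choose 2 * p ^ n.choose 3 *
      q ^ (n.choose 2 + 2 * n.choose 3) := by
  induction n with
  | zero => simp
  | succ n ih =>
    have hpk : ∀ (k : ℕ) x, p ^ k * x = x * p ^ k := fun k x => (Commute.pow_left (hp x) k).eq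
    have hqk : ∀ (k : ℕ) x, q ^ k * x = x * q ^ k := fun k x => (Commute.pow_left (hq x) k).eq
    set a := n.choose 2 with ha
    set b := n.choose 3
    have h2 : (n + 1).choose 2 = n + a := by rw [Nat.choose_succ_succ' n 1, Nat.choose_one_right]
    have h3 : (n + 1).choose 3 = a + b := by rw [Nat.choose_succ_succ' n 2]
    -- New factors: `p ^ a` and `q ^ a` from `g` and `h` crossing `c ^ a`, then `c ^ n` and `q ^ a`
    -- from `g` crossing `h ^ n`, and `q ^ n` from `h` crossing `c ^ n`. The exponent of `q` becomes
    -- `n + 3a + 2b = (n + a) + 2(a + b)`.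
    calc (g * h) ^ (n + 1) = g ^ n * h ^ n * c ^ a * (p ^ b * (q ^ (a + 2 * b) * (g * h))) := by
          rw [pow_succ, ih]; simp only [mul_assoc]
      _ = g ^ n * h ^ n * (c ^ a * g) * h * p ^ b * q ^ (a + 2 * b) := by
          rw [hqk, ← mul_assoc (p ^ b), hpk]; simp only [mul_assoc]
      _ = g ^ n * h ^ n * g * c ^ a * (p ^ a * h) * p ^ b * q ^ (a + 2 * b) := by
          rw [pow_mul_comm_of_commute hcg (hp c)]; simp only [mul_assoc]
      _ = g ^ n * h ^ n * g * (c ^ a * h) * p ^ a * p ^ b * q ^ (a + 2 * b) := by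
          rw [hpk]; simp only [mul_assoc]
      _ = g ^ n * (h ^ n * g) * h * c ^ a * (q ^ a * (p ^ (a + b))) * q ^ (a + 2 * b) := by
          rw [pow_mul_comm_of_commute hch (hq c), pow_add p]; simp only [mul_assoc]
      _ = g ^ n * g * h ^ n * c ^ n * (q ^ a * h) * c ^ a * p ^ (a + b) * q ^ a *
            q ^ (a + 2 * b) := by
          rw [pow_mul_eq hgh hch hq, ← ha, hqk a (p ^ _)]; simp only [mul_assoc]
      _ = g ^ n * g * h ^ n * (c ^ n * h) * (q ^ a * (c ^ a * p ^ (a + b))) * q ^ a *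
            q ^ (a + 2 * b) := by
          rw [hqk a h]; simp only [mul_assoc]
      _ = g ^ n * g * h ^ n * h * c ^ n * (q ^ n * (c ^ a * p ^ (a + b) * q ^ a)) * q ^ a *
            q ^ (a + 2 * b) := by
          rw [pow_mul_comm_of_commute hch (hq c), hqk a (c ^ a * _)]; simp only [mul_assoc]
      _ = g ^ n * g * (h ^ n * h) * (c ^ n * c ^ a) * p ^ (a + b) *
            (q ^ a * q ^ n * q ^ a * q ^ (a + 2 * b)) := by
          rw [hqk n]; simp only [mul_assoc]
      _ = _ := by
          rw [h2, h3, ← pow_succ, ← pow_succ, ← pow_add, ← pow_add, ← pow_add, ← pow_add]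
          congr 2
          ring

end ClassThree

/-! ### Identities of logarithms obtained by comparing linear coefficients. -/

section Log

open Polynomial

variable {H A : Type*} [Group H] [Ring A] [Algebra ℚ A]

/-- `ℓ` is a logarithm for `ι`: the sequence `ι (z ^ m n)`, `m` polynomial with `m 0 = 0`, is
polynomial with linear coefficient `m'(0) ℓ z`. -/
def IsLog (ι : H →* A) (ℓ : H → A) : Prop :=
  ∀ (z : H) (m : ℕ → ℕ) (q : ℚ[X]), (∀ n : ℕ, q.eval (n : ℚ) = m n) → m 0 = 0 →
    HasLinearCoeff (fun n => ι (z ^ m n)) 1 (q.coeff 1 • ℓ z)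

lemma isLog_of_pow_eq_zero (ι : H →* A) (N : ℕ) (h : ∀ z, (ι z - 1) ^ N = 0) :
    IsLog ι fun z => ∑ k ∈ Finset.Ico 1 N, ((-1) ^ (k + 1) / (k : ℚ)) • (ι z - 1) ^ k := by
  intro z m q hq hm
  simp only [map_pow]
  exact hasLinearCoeff_pow (h z) hq hm

namespace IsLog

variable {ι : H →* A} {ℓ : H → A} (hℓ : IsLog ι ℓ)
include hℓ

lemma pow_mul (z : H) (k : ℕ) : HasLinearCoeff (fun n => ι (z ^ (k * n))) 1 ((k : ℚ) • ℓ z) := by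
  have := hℓ z (fun n => k * n) (C (k : ℚ) * X) (by simp) (by simp)
  simpa using this

lemma pow (z : H) : HasLinearCoeff (fun n => ι (z ^ n)) 1 (ℓ z) := by
  simpa using hℓ.pow_mul z 1

lemma pow_choose_two (z : H) :
    HasLinearCoeff (fun n => ι (z ^ n.choose 2)) 1 ((-1 / 2 : ℚ) • ℓ z) := by
  have := hℓ z (fun n => n.choose 2) (choosePoly 2) (fun n => choosePoly_eval n 2) rfl
  rw [choosePoly_coeff_one] at this
  convert this using 2
  norm_num

lemma pow_choose_three (z : H) :
    HasLinearCoeff (fun n => ι (z ^ n.choose 3)) 1 ((1 / 3 : ℚ) • ℓ z) := by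
  have := hℓ z (fun n => n.choose 3) (choosePoly 3) (fun n => choosePoly_eval n 3) rfl
  rw [choosePoly_coeff_one] at this
  convert this using 2
  norm_num

lemma one : ℓ 1 = 0 :=
  (hℓ.pow 1).unique ((HasLinearCoeff.const 1).congr (by simp) rfl)

lemma npow (z : H) (k : ℕ) : ℓ (z ^ k) = (k : ℚ) • ℓ z :=
  (hℓ.pow (z ^ k)).unique ((hℓ.pow_mul z k).congr (fun n => by rw [_root_.pow_mul]) rfl)

lemma inv (z : H) : ℓ z⁻¹ = -ℓ z := by
  have h := ((hℓ.pow z⁻¹).mul (hℓ.pow z)).unique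
    ((HasLinearCoeff.const 1).congr (fun n => by rw [← map_mul]; simp) rfl)
  rw [one_mul, mul_one, add_comm] at h
  exact eq_neg_of_add_eq_zero_left h

lemma conj (g h : H) : ℓ (h⁻¹ * g * h) = ι h⁻¹ * ℓ g * ι h := by
  have h1 := ((HasLinearCoeff.const (ι h⁻¹)).mul (hℓ.pow g)).mul (HasLinearCoeff.const (ι h))
  refine (hℓ.pow _).unique (h1.congr (fun n => ?_) (by simp))
  have := conj_pow (a := h⁻¹) (b := g) (i := n)
  rw [inv_inv] at this
  rw [this, map_mul, map_mul]

/-- Linear part of the collection formula. The polynomials `n.choose 2` and `n.choose 3` have linear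
coefficients -1/2 and 1/3, so `q` contributes -1/2 + 2/3 = 1/6. -/
lemma mul_eq {g h c p q : H} (hgh : h * g = g * h * c) (hcg : c * g = g * c * p)
    (hch : c * h = h * c * q) (hp : ∀ x, p * x = x * p) (hq : ∀ x, q * x = x * q) :
    ℓ (g * h) = ℓ g + ℓ h - (1 / 2 : ℚ) • ℓ c + (1 / 3 : ℚ) • ℓ p + (1 / 6 : ℚ) • ℓ q := by
  refine (hℓ.pow _).unique ((((((hℓ.pow g).mul (hℓ.pow h)).mul (hℓ.pow_choose_two c)).mul
    (hℓ.pow_choose_three p)).mul ((hℓ.pow_choose_two q).mul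
      ((hℓ.pow_choose_three q).mul (hℓ.pow_choose_three q)))).congr (fun n => ?_) ?_)
  · rw [mul_pow_eq hgh hcg hch hp hq]
    simp only [← map_mul, ← pow_add]
    rw [two_mul]
  · simp only [one_mul, mul_one]
    module

lemma mul_of_commute {g h : H} (hgh : Commute g h) : ℓ (g * h) = ℓ g + ℓ h := by
  have := hℓ.mul_eq (g := g) (h := h) (c := 1) (p := 1) (q := 1) (by simp [hgh.eq]) (by simp)
    (by simp) (by simp) (by simp)
  simpa [hℓ.one] using this

/-- The bracket of two logarithms, in class three. -/
lemma lie_eq {g h c k m : H} (hgh : g * h = h * g * c) (hcg : c * g = g * c * k)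
    (hch : c * h = h * c * m) (hk : ∀ x, k * x = x * k) (hm : ∀ x, m * x = x * m) :
    ⁅ℓ g, ℓ h⁆ = ℓ c - (1 / 2 : ℚ) • ℓ k - (1 / 2 : ℚ) • ℓ m := by
  -- Conjugation by `h ^ n` turns `g` into `g * c ^ n * m ^ n.choose 2`, whose logarithm the product
  -- formula evaluates as a polynomial in `n`.
  have hlog : ∀ n : ℕ, ℓ ((h ^ n)⁻¹ * g * h ^ n) =
      ℓ g + (n : ℚ) • (ℓ c - (1 / 2 : ℚ) • ℓ k) + (n.choose 2 : ℚ) • ℓ m := by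
    intro n
    have e1 : (h ^ n)⁻¹ * g * h ^ n = (g * c ^ n) * m ^ n.choose 2 := by
      have hgh' : ∀ n : ℕ, g * h ^ n = h ^ n * g * c ^ n * m ^ n.choose 2 := by
        intro n
        induction n with
        | zero => simp
        | succ n ih =>
          have hmk : ∀ (j : ℕ) x, m ^ j * x = x * m ^ j :=
            fun j x => (Commute.pow_left (hm x) j).eq
          calc g * h ^ (n + 1) = h ^ n * g * c ^ n * (m ^ n.choose 2 * h) := by
                rw [pow_succ, ← mul_assoc, ih]; simp only [mul_assoc]
            _ = h ^ n * g * (c ^ n * h) * m ^ n.choose 2 := by rw [hmk]; simp only [mul_assoc]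
            _ = h ^ n * (g * h) * c ^ n * m ^ n * m ^ n.choose 2 := by
                rw [pow_mul_comm_of_commute hch (hm c)]; simp only [mul_assoc]
            _ = h ^ n * h * g * (c * c ^ n) * (m ^ n * m ^ n.choose 2) := by
                rw [hgh]; simp only [mul_assoc]
            _ = _ := by
                rw [← pow_succ, ← pow_succ', ← pow_add, Nat.choose_succ_succ' n 1,
                  Nat.choose_one_right]
      rw [mul_assoc, hgh']; simp only [mul_assoc, inv_mul_cancel_left]
    have hmc : Commute (g * c ^ n) (m ^ n.choose 2) := (Commute.pow_left (hm _) _).symm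
    rw [e1, hℓ.mul_of_commute hmc, hℓ.npow, hℓ.mul_eq (g := g) (h := c ^ n) (c := k ^ n) (p := 1)
      (q := 1) (pow_mul_comm_of_commute hcg (hk c) n)
      (by rw [(Commute.pow_left (hk g) n).eq, mul_one])
      (by rw [(Commute.pow_left (hk _) n).eq, mul_one]) (by simp) (by simp), hℓ.one, hℓ.npow, hℓ.npow]
    module
  -- The same logarithm is `ι(h)⁻ⁿ ℓ(g) ι(h)ⁿ`, whose linear coefficient is the bracket of `ℓ g` and
  -- `ℓ h`.
  have h1 := ((hℓ.pow h⁻¹).mul (HasLinearCoeff.const (ℓ g))).mul (hℓ.pow h)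
  have h2 := ((HasLinearCoeff.const (ℓ g)).add (HasLinearCoeff.eval_smul X
    (ℓ c - (1 / 2 : ℚ) • ℓ k))).add (HasLinearCoeff.eval_smul (choosePoly 2) (ℓ m))
  have h3 := h1.unique (h2.congr (fun n => by
    rw [choosePoly_eval, eval_X, ← hlog, hℓ.conj, inv_pow]) rfl)
  rw [choosePoly_coeff_one, coeff_X_one, hℓ.inv] at h3
  rw [LieRing.of_associative_ring_bracket]
  calc _ = 1 * ℓ g * ℓ h + (1 * 0 + -ℓ h * ℓ g) * 1 := by noncomm_ring
    _ = _ := h3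
    _ = _ := by push_cast; module

end IsLog

end Log
end MagnusLie

namespace MagnusLie

/-! ### The Lie algebra spanned by the logarithms in the completed group algebra. -/

section GroupLog

variable {G : Type*} [Group G]

lemma of_sub_one_mem_augIdeal (g : G) : MonoidAlgebra.of ℚ G g - 1 ∈ augIdeal ℚ G := by
  simp [augIdeal, RingHom.mem_ker]

/-- The map `G → (ℚG / Δ^N)ˣ`, as a map to `ℚG / Δ^N`. -/
noncomputable def truncHom (G : Type*) [Group G] (N : ℕ) :
    G →* MonoidAlgebra ℚ G ⧸ (augIdeal ℚ G) ^ N :=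
  (Ideal.Quotient.mk ((augIdeal ℚ G) ^ N) : _ →* _).comp (MonoidAlgebra.of ℚ G)

/-- Modulo `Δ ^ N` the powers `(g - 1) ^ k` with `k ≥ N` vanish, so the truncated series is the full
logarithm of a unipotent element. Identities in `Γ*` may thus be checked one component at a time. -/
lemma isLog_groupLog (N : ℕ) : IsLog (truncHom G N) fun g => (groupLog ℚ g).1 N := by
  have h1 : ∀ g : G, truncHom G N g - 1 =
      Ideal.Quotient.mk ((augIdeal ℚ G) ^ N) (MonoidAlgebra.of ℚ G g - 1) := by
    intro g; rw [map_sub, map_one]; rfl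
  convert isLog_of_pow_eq_zero (truncHom G N) N (fun g => ?_) using 2 with g
  · change Ideal.Quotient.mk _ (logTrunc ℚ g N) = _
    have h2 : ∀ (r : ℚ) (x : MonoidAlgebra ℚ G), Ideal.Quotient.mk ((augIdeal ℚ G) ^ N) (r • x) =
      r • Ideal.Quotient.mk ((augIdeal ℚ G) ^ N) x := fun r x => rfl
    simp only [logTrunc, map_sum, h2, h1, map_pow]
  · rw [h1, ← map_pow, Ideal.Quotient.eq_zero_iff_mem]
    exact Ideal.pow_mem_pow (of_sub_one_mem_augIdeal g) N

lemma mul_eq_mul_gcomm (a b : G) : a * b = b * a * gcomm a b := by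
  simp [gcomm, mul_assoc]

lemma gcomm_eq_one_iff {a b : G} : gcomm a b = 1 ↔ a * b = b * a := by
  rw [gcomm, mul_assoc, mul_eq_one_iff_inv_eq, mul_inv_rev, inv_inv, inv_inv]
  exact eq_comm

lemma groupLog_one : groupLog ℚ (1 : G) = 0 := by
  ext N
  exact (isLog_groupLog N).one

lemma groupLog_mul (hG : ∀ a b c d : G, gcomm (gcomm (gcomm a b) c) d = 1) (g h : G) :
    groupLog ℚ (g * h) = groupLog ℚ g + groupLog ℚ h - (1 / 2 : ℚ) • groupLog ℚ (gcomm h g) +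
      (1 / 3 : ℚ) • groupLog ℚ (gcomm (gcomm h g) g) +
      (1 / 6 : ℚ) • groupLog ℚ (gcomm (gcomm h g) h) := by
  ext N
  exact (isLog_groupLog N).mul_eq (mul_eq_mul_gcomm h g) (mul_eq_mul_gcomm _ _)
    (mul_eq_mul_gcomm _ _) (fun x => gcomm_eq_one_iff.1 (hG _ _ _ x))
    (fun x => gcomm_eq_one_iff.1 (hG _ _ _ x))

lemma lie_groupLog (hG : ∀ a b c d : G, gcomm (gcomm (gcomm a b) c) d = 1) (g h : G) :
    ⁅groupLog ℚ g, groupLog ℚ h⁆ = groupLog ℚ (gcomm g h) -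
      (1 / 2 : ℚ) • groupLog ℚ (gcomm (gcomm g h) g) -
      (1 / 2 : ℚ) • groupLog ℚ (gcomm (gcomm g h) h) := by
  ext N
  exact (isLog_groupLog N).lie_eq (mul_eq_mul_gcomm g h) (mul_eq_mul_gcomm _ _)
    (mul_eq_mul_gcomm _ _) (fun x => gcomm_eq_one_iff.1 (hG _ _ _ x))
    (fun x => gcomm_eq_one_iff.1 (hG _ _ _ x))

lemma groupLog_mem_logSpan (g : G) : groupLog ℚ g ∈ logSpan ℚ G :=
  Submodule.subset_span ⟨g, rfl⟩

lemma lie_mem_logSpan (hG : ∀ a b c d : G, gcomm (gcomm (gcomm a b) c) d = 1)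
    {x y : completion ℚ G} (hx : x ∈ logSpan ℚ G) (hy : y ∈ logSpan ℚ G) :
    ⁅x, y⁆ ∈ logSpan ℚ G := by
  induction hx using Submodule.span_induction with
  | zero => simp
  | add x x' _ _ h h' => rw [add_lie]; exact add_mem h h'
  | smul r x _ h => rw [smul_lie]; exact Submodule.smul_mem _ _ h
  | mem x hx =>
    induction hy using Submodule.span_induction with
    | zero => simp
    | add x x' _ _ h h' => rw [lie_add]; exact add_mem h h'
    | smul r x _ h => rw [lie_smul]; exact Submodule.smul_mem _ _ h
    | mem y hy =>
      obtain ⟨g, rfl⟩ := hx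
      obtain ⟨h, rfl⟩ := hy
      rw [lie_groupLog hG]
      exact sub_mem (sub_mem (groupLog_mem_logSpan _)
        (Submodule.smul_mem _ _ (groupLog_mem_logSpan _)))
        (Submodule.smul_mem _ _ (groupLog_mem_logSpan _))

/-- `𝓛_ℚ(G)` as a Lie algebra, for `G` nilpotent of class at most three. -/
noncomputable def logLie (hG : ∀ a b c d : G, gcomm (gcomm (gcomm a b) c) d = 1) :
    LieSubalgebra ℚ (completion ℚ G) where
  __ := logSpan ℚ G
  lie_mem' hx hy := lie_mem_logSpan hG hx hy

/-- The identities of `log` in class three. -/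
structure IsLieLog {M : Type*} [LieRing M] [LieAlgebra ℚ M] (ℓ : G → M) : Prop where
  one : ℓ 1 = 0
  mul (g h : G) : ℓ (g * h) = ℓ g + ℓ h - (1 / 2 : ℚ) • ℓ (gcomm h g) +
    (1 / 3 : ℚ) • ℓ (gcomm (gcomm h g) g) + (1 / 6 : ℚ) • ℓ (gcomm (gcomm h g) h)
  lie (g h : G) : ⁅ℓ g, ℓ h⁆ = ℓ (gcomm g h) - (1 / 2 : ℚ) • ℓ (gcomm (gcomm g h) g) -
    (1 / 2 : ℚ) • ℓ (gcomm (gcomm g h) h)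
  span : Submodule.span ℚ (Set.range ℓ) = ⊤

/-- Descent on the length of commutators: for `(a, b)` and `c` the bracket formula has no correction
terms, so `μ ∘ ℓ` kills triple commutators, then all commutators, and only the linear terms of the
product formula remain. -/
lemma IsLieLog.linearMap_mul {M : Type*} [LieRing M] [LieAlgebra ℚ M] {ℓ : G → M}
    (hℓ : IsLieLog ℓ) (hG : ∀ a b c d : G, gcomm (gcomm (gcomm a b) c) d = 1)
    (μ : M →ₗ[ℚ] ℚ) (hμ : ∀ x y : M, μ ⁅x, y⁆ = 0) (g h : G) :
    μ (ℓ (g * h)) = μ (ℓ g) + μ (ℓ h) := by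
  have h3 : ∀ a b c, μ (ℓ (gcomm (gcomm a b) c)) = 0 := by
    intro a b c
    have := hμ (ℓ (gcomm a b)) (ℓ c)
    rw [hℓ.lie, hG, hG, hℓ.one] at this
    simpa using this
  have h2 : ∀ a b, μ (ℓ (gcomm a b)) = 0 := by
    intro a b
    have := hμ (ℓ a) (ℓ b)
    rw [hℓ.lie] at this
    simpa [h3] using this
  simp [hℓ.mul, h2]

set_option synthInstance.maxHeartbeats 400000 in
lemma isLieLog_logLie (hG : ∀ a b c d : G, gcomm (gcomm (gcomm a b) c) d = 1) :
    IsLieLog (M := logLie hG) fun g => ⟨groupLog ℚ g, groupLog_mem_logSpan g⟩ where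
  one := Subtype.ext groupLog_one
  mul g h := Subtype.ext (groupLog_mul hG g h)
  lie g h := Subtype.ext (lie_groupLog hG g h)
  span := by
    rw [eq_top_iff]
    rintro ⟨x, hx⟩ -
    induction hx using Submodule.span_induction with
    | zero => exact zero_mem _
    | add x y hx hy h h' => exact add_mem h h'
    | smul r x hx h => exact Submodule.smul_mem _ r h
    | mem x hx => obtain ⟨g, rfl⟩ := hx; exact Submodule.subset_span ⟨g, rfl⟩

end GroupLog
end MagnusLie

namespace MagnusLie

/-! ### Matrices that raise weights, and representations of `L` by them. -/

section Weight

attribute [local instance 100] LieRing.ofAssociativeRing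

variable {ι : Type*}

/-- The matrices whose `(i, j)` entry vanishes unless `d j ≥ d i + n`. -/
def weightFiltration (d : ι → ℕ) (n : ℕ) : Submodule ℚ (Matrix ι ι ℚ) where
  carrier := {M | ∀ i j, d j < d i + n → M i j = 0}
  zero_mem' := fun _ _ _ => rfl
  add_mem' := fun h h' i j hij => by rw [Matrix.add_apply, h i j hij, h' i j hij, add_zero]
  smul_mem' := fun r M h i j hij => by rw [Matrix.smul_apply, h i j hij, smul_zero]

variable {d : ι → ℕ}

lemma one_mem_weightFiltration [DecidableEq ι] : (1 : Matrix ι ι ℚ) ∈ weightFiltration d 0 := by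
  intro i j h
  exact Matrix.one_apply_ne (by rintro rfl; omega)

lemma weightFiltration_anti {m n : ℕ} (h : m ≤ n) : weightFiltration d n ≤ weightFiltration d m :=
  fun _ hM i j hij => hM i j (by omega)

lemma eq_zero_of_mem_weightFiltration {n : ℕ} (hd : ∀ i, d i < n) {M : Matrix ι ι ℚ}
    (hM : M ∈ weightFiltration d n) : M = 0 := by
  ext i j
  exact hM i j (by have := hd j; omega)

variable [Fintype ι]

lemma mul_mem_weightFiltration {m n : ℕ} {M N : Matrix ι ι ℚ} (hM : M ∈ weightFiltration d m)
    (hN : N ∈ weightFiltration d n) : M * N ∈ weightFiltration d (m + n) := by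
  intro i j hij
  rw [Matrix.mul_apply]
  refine Finset.sum_eq_zero fun k _ => ?_
  by_cases h : d k < d i + m
  · rw [hM i k h, zero_mul]
  · rw [hN k j (by omega), mul_zero]

variable [DecidableEq ι]

lemma lie_mem_weightFiltration {m n : ℕ} {M N : Matrix ι ι ℚ} (hM : M ∈ weightFiltration d m)
    (hN : N ∈ weightFiltration d n) : ⁅M, N⁆ ∈ weightFiltration d (m + n) := by
  rw [LieRing.of_associative_ring_bracket]
  exact sub_mem (mul_mem_weightFiltration hM hN) (add_comm m n ▸ mul_mem_weightFiltration hN hM)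

variable {L : Type*} [LieRing L] [LieAlgebra ℚ L]

/-- The term of index `k` is `γ_{k+1}`, spanned by brackets of length `k + 1`, which explains the
shift in the weight. -/
lemma map_lowerCentralSeries_mem_weightFiltration (ρ : L →ₗ⁅ℚ⁆ Matrix ι ι ℚ)
    (hρ : ∀ x, ρ x ∈ weightFiltration d 1) (k : ℕ) {x : L}
    (hx : x ∈ LieModule.lowerCentralSeries ℚ L L k) : ρ x ∈ weightFiltration d (k + 1) := by
  let J : ℕ → LieIdeal ℚ L := fun k =>
    { (weightFiltration d (k + 1)).comap (ρ : L →ₗ[ℚ] Matrix ι ι ℚ) with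
      lie_mem := by
        intro x m hm
        change ρ ⁅x, m⁆ ∈ weightFiltration d (k + 1)
        rw [LieHom.map_lie]
        exact weightFiltration_anti (by omega) (lie_mem_weightFiltration (hρ x) hm) }
  have hJ : LieModule.lowerCentralSeries ℚ L L k ≤ J k := by
    clear hx
    induction k with
    | zero => exact fun x _ => hρ x
    | succ k ih =>
      rw [LieModule.lowerCentralSeries_succ, LieSubmodule.lie_le_iff]
      intro y _ m hm
      change ρ ⁅y, m⁆ ∈ weightFiltration d (k + 1 + 1)
      rw [LieHom.map_lie, add_comm (k + 1)]
      exact lie_mem_weightFiltration (hρ y) (ih hm)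
  exact hJ hx

end Weight

section LieQuotient

variable {L L' : Type*} [LieRing L] [LieAlgebra ℚ L] [LieRing L'] [LieAlgebra ℚ L']

/-- The homomorphism from the quotient of a Lie algebra by an ideal contained in the kernel. -/
def lieQuotLift (I : LieIdeal ℚ L) (f : L →ₗ⁅ℚ⁆ L') (h : I ≤ f.ker) : L ⧸ I →ₗ⁅ℚ⁆ L' where
  __ := Submodule.liftQ I.toSubmodule (f : L →ₗ[ℚ] L') fun x hx => f.mem_ker.1 (h hx)
  map_lie' := by
    intro x y
    obtain ⟨x, rfl⟩ := LieSubmodule.Quotient.surjective_mk' I x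
    obtain ⟨y, rfl⟩ := LieSubmodule.Quotient.surjective_mk' I y
    exact f.map_lie x y

/-- By the universal property, the identity factors through the inclusion of any subalgebra
containing the generators. -/
lemma freeLieAlgebra_mem {X : Type*} (K : LieSubalgebra ℚ (FreeLieAlgebra ℚ X))
    (h : ∀ i, FreeLieAlgebra.of ℚ i ∈ K) (x : FreeLieAlgebra ℚ X) : x ∈ K := by
  let f : FreeLieAlgebra ℚ X →ₗ⁅ℚ⁆ K := FreeLieAlgebra.lift ℚ fun i => ⟨_, h i⟩
  have : K.incl.comp f = LieHom.id := FreeLieAlgebra.hom_ext fun i => by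
    simp [f]
  have h2 := congrArg (fun g => g x) this
  simp only [LieHom.comp_apply, LieHom.id_apply] at h2
  rw [← h2]
  exact (f x).2

end LieQuotient

section NilLie

/-- The Lie algebra `L`, with a unique path to its bracket. -/
def NilLie : Type := ExampleLie

noncomputable instance : LieRing NilLie := inferInstanceAs (LieRing ExampleLie)

noncomputable instance : LieAlgebra ℚ NilLie := inferInstanceAs (LieAlgebra ℚ ExampleLie)

/-- The underlying element of `L`. -/
def ExampleGroup.toNil (x : ExampleGroup) : NilLie := x

/-- The generator `y_{i+1}` of `L`. -/
noncomputable def genN (i : Fin 4) : NilLie := genY i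

lemma nilLie_class (a b c d : NilLie) : ⁅⁅⁅a, b⁆, c⁆, d⁆ = 0 := exampleLie_class a b c d

/-- The projection of the free Lie algebra onto `L`. -/
noncomputable def toNilLie : FreeLie4 →ₗ⁅ℚ⁆ NilLie where
  toFun a := (LieSubmodule.Quotient.mk (LieSubmodule.Quotient.mk a : FreeNilp) : ExampleLie)
  map_add' _ _ := rfl
  map_smul' _ _ := rfl
  map_lie' := rfl

lemma toNilLie_surjective : Function.Surjective toNilLie := by
  intro x
  obtain ⟨a, rfl⟩ := LieSubmodule.Quotient.surjective_mk' _ x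
  obtain ⟨a, rfl⟩ := LieSubmodule.Quotient.surjective_mk' _ a
  exact ⟨a, rfl⟩

lemma nilLie_mem (K : LieSubalgebra ℚ NilLie) (h : ∀ i, genN i ∈ K) (x : NilLie) : x ∈ K := by
  obtain ⟨a, rfl⟩ := toNilLie_surjective x
  exact freeLieAlgebra_mem (K.comap toNilLie) h a

lemma genN_relation : ⁅genN 0, genN 1⁆ = -⁅⁅genN 2, genN 3⁆, genN 2⁆ := by
  rw [eq_neg_iff_add_eq_zero]
  exact (LieSubmodule.Quotient.mk_eq_zero' (N := LieSubmodule.lieSpan ℚ FreeNilp {relator})).2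
    (LieSubmodule.subset_lieSpan (Set.mem_singleton relator))

end NilLie

section Rep

attribute [local instance 100] LieRing.ofAssociativeRing

variable {ι : Type*} [Fintype ι] [DecidableEq ι] {d : ι → ℕ}

/-- All weights are below four, so a matrix raising weights by four is zero. Hence `γ_4` is killed
automatically and the relator is the only condition on the four matrices. -/
lemma exists_representation (hd : ∀ i, d i < 4) (Y : Fin 4 → Matrix ι ι ℚ)
    (hY : ∀ i, Y i ∈ weightFiltration d 1) (hrel : ⁅Y 0, Y 1⁆ + ⁅⁅Y 2, Y 3⁆, Y 2⁆ = 0) :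
    ∃ ρ : NilLie →ₗ⁅ℚ⁆ Matrix ι ι ℚ, (∀ i, ρ (genN i) = Y i) ∧
      ∀ x, ρ x ∈ weightFiltration d 1 := by
  let K : LieSubalgebra ℚ (Matrix ι ι ℚ) :=
    { weightFiltration d 1 with
      lie_mem' := fun hx hy => weightFiltration_anti (by omega) (lie_mem_weightFiltration hx hy) }
  let f : FreeLie4 →ₗ⁅ℚ⁆ Matrix ι ι ℚ := FreeLieAlgebra.lift ℚ Y
  have hf : ∀ x, f x ∈ weightFiltration d 1 := fun x =>
    freeLieAlgebra_mem (K.comap f) (fun i => by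
      change f _ ∈ weightFiltration d 1
      simpa [f] using hY i) x
  let g : FreeNilp →ₗ⁅ℚ⁆ Matrix ι ι ℚ := lieQuotLift _ f fun x hx => f.mem_ker.2
    (eq_zero_of_mem_weightFiltration hd (map_lowerCentralSeries_mem_weightFiltration f hf 3 hx))
  have hg : ∀ i, g (genX i) = Y i := fun i => FreeLieAlgebra.lift_of_apply Y i
  have hrel' : g relator = 0 := by
    simp only [relator, map_add, LieHom.map_lie, hg, hrel]
  let ρ : NilLie →ₗ⁅ℚ⁆ Matrix ι ι ℚ := lieQuotLift (LieSubmodule.lieSpan ℚ FreeNilp {relator}) g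
    (LieSubmodule.lieSpan_le.2 (Set.singleton_subset_iff.2 (g.mem_ker.2 hrel')))
  have hρ : ∀ i, ρ (genN i) = Y i := hg
  exact ⟨ρ, hρ, nilLie_mem (K.comap ρ) fun i => by
    change ρ _ ∈ weightFiltration d 1
    rw [hρ]; exact hY i⟩

end Rep

/-! ### From representations of `L` to representations of `R` and of `Γ*`. -/

section Exp

attribute [local instance 100] LieRing.ofAssociativeRing

variable {A : Type*} [Ring A] [Algebra ℚ A]

/-- The exponential series, truncated in degree four. -/
def expTrunc (x : A) : A := 1 + x + (1 / 2 : ℚ) • (x * x) + (1 / 6 : ℚ) • (x * (x * x))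

/-- The Baker-Campbell-Hausdorff formula in an algebra where products of four factors vanish. -/
lemma expTrunc_bch {x y : A} (h : ∀ a ∈ ({x, y} : Set A), ∀ b ∈ ({x, y} : Set A),
    ∀ c ∈ ({x, y} : Set A), ∀ d ∈ ({x, y} : Set A), a * (b * (c * d)) = 0) :
    expTrunc (bch x y) = expTrunc x * expTrunc y := by
  simp only [Set.mem_insert_iff, Set.mem_singleton_iff, forall_eq_or_imp, forall_eq] at h
  simp only [expTrunc, bch, LieRing.of_associative_ring_bracket, mul_add, add_mul, mul_sub, sub_mul,
    smul_mul_assoc, mul_smul_comm, mul_assoc, h, mul_one, one_mul, smul_zero, smul_add, smul_sub,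
    add_zero, sub_zero, mul_zero]
  module

/-- `log (exp x) = x`. -/
lemma log_expTrunc {x : A} (h : x * (x * (x * x)) = 0) :
    ∑ k ∈ Finset.Ico (1 : ℕ) 4, ((-1) ^ (k + 1) / (k : ℚ)) • (expTrunc x - 1) ^ k = x := by
  have e : expTrunc x - 1 = x + (1 / 2 : ℚ) • (x * x) + (1 / 6 : ℚ) • (x * (x * x)) := by
    unfold expTrunc; abel
  rw [Finset.sum_Ico_eq_sum_range, e]
  simp only [Finset.sum_range_succ, Finset.sum_range_zero, pow_succ, pow_zero, mul_add, add_mul,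
    smul_mul_assoc, mul_smul_comm, mul_assoc, h, one_mul, smul_zero, smul_add, add_zero, zero_add,
    mul_zero]
  module

end Exp

section MatrixRep

attribute [local instance 100] LieRing.ofAssociativeRing

variable {ι : Type*} [Fintype ι] {d : ι → ℕ}

lemma mul_four_eq_zero (hd : ∀ i, d i < 4) {a b c e : Matrix ι ι ℚ} (ha : a ∈ weightFiltration d 1)
    (hb : b ∈ weightFiltration d 1) (hc : c ∈ weightFiltration d 1)
    (he : e ∈ weightFiltration d 1) : a * (b * (c * e)) = 0 :=
  eq_zero_of_mem_weightFiltration hd (mul_mem_weightFiltration ha (mul_mem_weightFiltration hb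
    (mul_mem_weightFiltration hc he)))

variable [DecidableEq ι]

/-- The representation `exp ∘ ρ` of `R`, for a representation `ρ` of `L`. -/
noncomputable def expHom (hd : ∀ i, d i < 4) (ρ : NilLie →ₗ⁅ℚ⁆ Matrix ι ι ℚ)
    (hρ : ∀ x, ρ x ∈ weightFiltration d 1) : ExampleGroup →* Matrix ι ι ℚ where
  toFun g := expTrunc (ρ g.toNil)
  map_one' := by
    change expTrunc (ρ 0) = 1
    simp [expTrunc]
  map_mul' g h := by
    change expTrunc (ρ (bch g.toNil h.toNil)) = _
    rw [← expTrunc_bch]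
    · rw [bch, bch]
      simp only [map_add, map_sub, map_smul, LieHom.map_lie]
    · have : ∀ a ∈ ({ρ g.toNil, ρ h.toNil} : Set (Matrix ι ι ℚ)), a ∈ weightFiltration d 1 := by
        rintro a (rfl | rfl)
        · exact hρ _
        · exact hρ _
      exact fun a ha b hb c hc e he =>
        mul_four_eq_zero hd (this a ha) (this b hb) (this c hc) (this e he)

lemma expTrunc_sub_one_mem {x : Matrix ι ι ℚ} (hx : x ∈ weightFiltration d 1) :
    expTrunc x - 1 ∈ weightFiltration d 1 := by
  have e : expTrunc x - 1 = x + (1 / 2 : ℚ) • (x * x) + (1 / 6 : ℚ) • (x * (x * x)) := by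
    unfold expTrunc; abel
  have h2 := mul_mem_weightFiltration hx hx
  rw [e]
  exact add_mem (add_mem hx (Submodule.smul_mem _ _ (weightFiltration_anti (by omega) h2)))
    (Submodule.smul_mem _ _ (weightFiltration_anti (by omega) (mul_mem_weightFiltration hx h2)))

variable {G : Type*} [Group G]

/-- On all of `ℚG` the representation agrees with the augmentation up to weight one; so `Δ` goes to
weight one and its powers follow by multiplicativity. -/
lemma lift_mem_weightFiltration (E : G →* Matrix ι ι ℚ) (hE : ∀ g, E g - 1 ∈ weightFiltration d 1)
    (n : ℕ) {x : MonoidAlgebra ℚ G} (hx : x ∈ (augIdeal ℚ G) ^ n) :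
    MonoidAlgebra.lift ℚ (Matrix ι ι ℚ) G E x ∈ weightFiltration d n := by
  have h0 : ∀ x : MonoidAlgebra ℚ G, MonoidAlgebra.lift ℚ (Matrix ι ι ℚ) G E x -
      MonoidAlgebra.lift ℚ ℚ G (1 : G →* ℚ) x • 1 ∈ weightFiltration d 1 := by
    intro x
    induction x using MonoidAlgebra.induction_on with
    | of g => simpa using hE g
    | add x y hx hy =>
      rw [map_add, map_add, add_smul, add_sub_add_comm]
      exact add_mem hx hy
    | smul r x hx =>
      rw [map_smul, map_smul, smul_eq_mul, mul_smul, ← smul_sub]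
      exact Submodule.smul_mem _ _ hx
  have h1 : ∀ x ∈ augIdeal ℚ G, MonoidAlgebra.lift ℚ (Matrix ι ι ℚ) G E x ∈
      weightFiltration d 1 := by
    intro x hx
    have := h0 x
    rwa [show MonoidAlgebra.lift ℚ ℚ G (1 : G →* ℚ) x = 0 from hx, zero_smul, sub_zero] at this
  induction n generalizing x with
  | zero =>
    have h2 := h0 x
    rw [← sub_add_cancel (MonoidAlgebra.lift ℚ (Matrix ι ι ℚ) G E x)
      (MonoidAlgebra.lift ℚ ℚ G (1 : G →* ℚ) x • 1)]
    exact add_mem (weightFiltration_anti (by omega) h2)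
      (Submodule.smul_mem _ _ one_mem_weightFiltration)
  | succ n ih =>
    rw [Submodule.pow_succ, ← smul_eq_mul] at hx
    refine Submodule.smul_induction_on hx (fun a ha b hb => ?_) fun a b ha hb => ?_
    · rw [smul_eq_mul, map_mul]
      exact mul_mem_weightFiltration (ih ha) (h1 b hb)
    · rw [map_add]; exact add_mem ha hb

/-- The extension of a unipotent matrix representation of `G` to `Γ*`. -/
noncomputable def completionLift (hd : ∀ i, d i < 4) (E : G →* Matrix ι ι ℚ)
    (hE : ∀ g, E g - 1 ∈ weightFiltration d 1) : completion ℚ G →ₐ[ℚ] Matrix ι ι ℚ :=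
  -- Since `Δ ^ 4` acts by zero, the component modulo `Δ ^ 4` of an element of `Γ*` is enough.
  ((Ideal.Quotient.liftₐ ((augIdeal ℚ G) ^ 4) (MonoidAlgebra.lift ℚ (Matrix ι ι ℚ) G E)
    fun _ hx => eq_zero_of_mem_weightFiltration hd (lift_mem_weightFiltration E hE 4 hx)).comp
    (Pi.evalAlgHom ℚ _ 4)).comp (completion ℚ G).val

lemma completionLift_groupLog (hd : ∀ i, d i < 4) (E : G →* Matrix ι ι ℚ)
    (hE : ∀ g, E g - 1 ∈ weightFiltration d 1) (g : G) :
    completionLift hd E hE (groupLog ℚ g) =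
      ∑ k ∈ Finset.Ico (1 : ℕ) 4, ((-1) ^ (k + 1) / (k : ℚ)) • (E g - 1) ^ k := by
  change MonoidAlgebra.lift ℚ (Matrix ι ι ℚ) G E (logTrunc ℚ g 4) = _
  simp only [logTrunc, map_sum, map_smul, map_pow, map_sub, map_one, MonoidAlgebra.lift_of]

/-- The representation `Γ* → M_n(ℚ)` with `log g ↦ ρ(g)`, for a representation `ρ` of `L`. -/
lemma exists_completion_representation (hd : ∀ i, d i < 4) (ρ : NilLie →ₗ⁅ℚ⁆ Matrix ι ι ℚ)
    (hρ : ∀ x, ρ x ∈ weightFiltration d 1) :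
    ∃ Φ : completion ℚ exampleH →ₗ[ℚ] Matrix ι ι ℚ, (∀ x y, Φ ⁅x, y⁆ = ⁅Φ x, Φ y⁆) ∧
      ∀ g : exampleH, Φ (groupLog ℚ g) = ρ (g : ExampleGroup).toNil := by
  let Φ := completionLift hd ((expHom hd ρ hρ).comp exampleH.subtype)
    fun g => expTrunc_sub_one_mem (hρ _)
  refine ⟨Φ.toLinearMap, fun x y => ?_, fun g => ?_⟩
  · change Φ (x * y - y * x) = Φ x * Φ y - Φ y * Φ x
    rw [map_sub, map_mul, map_mul]
  · refine (completionLift_groupLog hd ((expHom hd ρ hρ).comp exampleH.subtype)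
      (fun g => expTrunc_sub_one_mem (hρ _)) g).trans ?_
    exact log_expTrunc (mul_four_eq_zero hd (hρ _) (hρ _) (hρ _) (hρ _))

end MatrixRep
end MagnusLie

namespace MagnusLie

/-! ### Coordinates on `L` modulo `γ_2` and on `γ_2` modulo `γ_3`. -/

section Functionals

attribute [local instance 100] LieRing.ofAssociativeRing

lemma lie_apply_zero_two {M N : Matrix (Fin 3) (Fin 3) ℚ}
    (hM : M ∈ weightFiltration (fun i : Fin 3 => (i : ℕ)) 1)
    (hN : N ∈ weightFiltration (fun i : Fin 3 => (i : ℕ)) 1) :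
    ⁅M, N⁆ 0 2 = M 0 1 * N 1 2 - N 0 1 * M 1 2 := by
  have h1 := hM 0 0 (by simp)
  have h2 := hM 2 2 (by simp)
  have h3 := hN 0 0 (by simp)
  have h4 := hN 2 2 (by simp)
  rw [LieRing.of_associative_ring_bracket, Matrix.sub_apply, Matrix.mul_apply, Matrix.mul_apply,
    Fin.sum_univ_three, Fin.sum_univ_three, h1, h2, h3, h4]
  ring

/-- The representations of `L` by strictly upper triangular matrices of size three. -/
lemma exists_heisenberg (a b : Fin 4 → ℚ) (h : a 0 * b 1 = a 1 * b 0) :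
    ∃ ρ : NilLie →ₗ⁅ℚ⁆ Matrix (Fin 3) (Fin 3) ℚ,
      (∀ x, ρ x ∈ weightFiltration (fun i : Fin 3 => (i : ℕ)) 1) ∧
      (∀ i, ρ (genN i) 0 1 = a i) ∧ ∀ i, ρ (genN i) 1 2 = b i := by
  set d : Fin 3 → ℕ := fun i => i with hd
  set Y : Fin 4 → Matrix (Fin 3) (Fin 3) ℚ := fun i => !![0, a i, 0; 0, 0, b i; 0, 0, 0] with hYdef
  have hY : ∀ i, Y i ∈ weightFiltration d 1 := by
    intro i j k hjk
    fin_cases j <;> fin_cases k <;> simp_all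
  obtain ⟨ρ, hρ, hρ'⟩ := exists_representation (d := d) (fun i => by simp only [hd]; omega) Y hY (by
    -- A triple bracket has weight three and vanishes in size three. The only entry left in `⁅Y 0, Y
    -- 1⁆` is the corner, equal to the minor that `h` makes zero.
    have h3 : ⁅⁅Y 2, Y 3⁆, Y 2⁆ = 0 := eq_zero_of_mem_weightFiltration (n := 1 + 1 + 1)
      (fun i => by simp only [hd]; omega)
      (lie_mem_weightFiltration (lie_mem_weightFiltration (hY 2) (hY 3)) (hY 2))
    rw [h3, add_zero]
    ext i j
    by_cases hij : d j < d i + (1 + 1)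
    · exact lie_mem_weightFiltration (hY 0) (hY 1) i j hij
    · obtain rfl : i = 0 := by simp only [hd] at hij; omega
      obtain rfl : j = 2 := by simp only [hd, Fin.val_zero] at hij; omega
      rw [lie_apply_zero_two (hY 0) (hY 1)]
      simp [Y, h])
  exact ⟨ρ, hρ', fun i => by simp [hρ, Y], fun i => by simp [hρ, Y]⟩

/-- A matrix entry of a representation of `L`. -/
noncomputable def entryMap (i j : Fin 3) (ρ : NilLie →ₗ⁅ℚ⁆ Matrix (Fin 3) (Fin 3) ℚ) : NilLie →ₗ[ℚ] ℚ :=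
  (Matrix.entryLinearMap ℚ ℚ i j).comp (ρ : NilLie →ₗ[ℚ] Matrix (Fin 3) (Fin 3) ℚ)

/-- With equal rows the minor condition of `exists_heisenberg` is automatic. The entry (0, 1) raises
the weight by one only, so brackets do not reach it. -/
lemma exists_coord (p : Fin 4) : ∃ α : NilLie →ₗ[ℚ] ℚ,
    (∀ j, α (genN j) = if j = p then 1 else 0) ∧ ∀ x y : NilLie, α ⁅x, y⁆ = 0 := by
  obtain ⟨ρ, hρ, h1, -⟩ := exists_heisenberg (fun j => if j = p then 1 else 0)
    (fun j => if j = p then 1 else 0) (mul_comm _ _)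
  refine ⟨entryMap 0 1 ρ, h1, fun x y => ?_⟩
  change ρ ⁅x, y⁆ 0 1 = 0
  rw [LieHom.map_lie]
  exact lie_mem_weightFiltration (hρ x) (hρ y) 0 1 (by simp)

/-- The coordinates of an element of `L` modulo `γ_2(L)`. -/
noncomputable def coord (p : Fin 4) : NilLie →ₗ[ℚ] ℚ := (exists_coord p).choose

lemma coord_genN (p j : Fin 4) : coord p (genN j) = if j = p then 1 else 0 :=
  (exists_coord p).choose_spec.1 j

lemma coord_lie (p : Fin 4) (x y : NilLie) : coord p ⁅x, y⁆ = 0 :=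
  (exists_coord p).choose_spec.2 x y

/-- The difference of the two sides kills brackets and generators, so its kernel is a subalgebra
containing the generators. -/
lemma linearMap_eq_sum_coord (f : NilLie →ₗ[ℚ] ℚ) (hf : ∀ x y : NilLie, f ⁅x, y⁆ = 0)
    (x : NilLie) : f x = ∑ i, coord i x * f (genN i) := by
  let g : NilLie →ₗ[ℚ] ℚ := f - ∑ i, f (genN i) • coord i
  have hg : ∀ x, g x = f x - ∑ i, coord i x * f (genN i) := by
    intro x
    simp [g, mul_comm]
  let K : LieSubalgebra ℚ NilLie :=
    { LinearMap.ker g with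
      lie_mem' := by
        intro x y _ _
        change g ⁅x, y⁆ = 0
        rw [hg]
        simp [hf, coord_lie] }
  have : g x = 0 := nilLie_mem K (fun i => by
    change g _ = 0
    rw [hg]
    simp [coord_genN]) x
  rw [hg, sub_eq_zero] at this
  exact this

lemma eq_coord (f : NilLie →ₗ[ℚ] ℚ) (hf : ∀ x y : NilLie, f ⁅x, y⁆ = 0) (p : Fin 4)
    (hp : ∀ j, f (genN j) = if j = p then 1 else 0) (x : NilLie) : f x = coord p x := by
  rw [linearMap_eq_sum_coord f hf]
  simp [hp]

/-- The two excluded pairs are exactly those for which the indicator rows give `[y_1, y_2]` a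
nonzero image. -/
lemma exists_heisenberg_coord {p q : Fin 4} (h : ¬(p = 0 ∧ q = 1)) (h' : ¬(p = 1 ∧ q = 0)) :
    ∃ ρ : NilLie →ₗ⁅ℚ⁆ Matrix (Fin 3) (Fin 3) ℚ,
      (∀ x, ρ x ∈ weightFiltration (fun i : Fin 3 => (i : ℕ)) 1) ∧
      (∀ x, ρ x 0 1 = coord p x) ∧ ∀ x, ρ x 1 2 = coord q x := by
  obtain ⟨ρ, hρ, h1, h2⟩ := exists_heisenberg (fun j => if j = p then 1 else 0)
    (fun j => if j = q then 1 else 0) (by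
      revert h h'
      fin_cases p <;> fin_cases q <;> simp)
  refine ⟨ρ, hρ, eq_coord (entryMap 0 1 ρ)
    (fun x y => ?_) p h1, eq_coord (entryMap 1 2 ρ)
    (fun x y => ?_) q h2⟩
  · change ρ ⁅x, y⁆ 0 1 = 0
    rw [LieHom.map_lie]
    exact lie_mem_weightFiltration (hρ x) (hρ y) 0 1 (by simp)
  · change ρ ⁅x, y⁆ 1 2 = 0
    rw [LieHom.map_lie]
    exact lie_mem_weightFiltration (hρ x) (hρ y) 1 2 (by simp)

/-- The coordinates of an element of `γ_2(L)` modulo `γ_3(L)`. -/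
lemma exists_pairing {p q : Fin 4} (h : ¬(p = 0 ∧ q = 1)) (h' : ¬(p = 1 ∧ q = 0)) :
    ∃ ω : NilLie →ₗ[ℚ] ℚ,
      (∀ x y : NilLie, ω ⁅x, y⁆ = coord p x * coord q y - coord p y * coord q x) ∧
      ∀ x ∈ LieModule.lowerCentralSeries ℚ NilLie NilLie 2, ω x = 0 := by
  obtain ⟨ρ, hρ, h1, h2⟩ := exists_heisenberg_coord h h'
  refine ⟨entryMap 0 2 ρ, fun x y => ?_,
    fun x hx => ?_⟩
  · change ρ ⁅x, y⁆ 0 2 = _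
    rw [LieHom.map_lie, lie_apply_zero_two (hρ x) (hρ y), h1, h1, h2, h2]
  · exact map_lowerCentralSeries_mem_weightFiltration ρ hρ 2 hx 0 2 (by simp)

lemma coord_eq_zero_of_mem (p : Fin 4) {x : NilLie}
    (hx : x ∈ LieModule.lowerCentralSeries ℚ NilLie NilLie 1) : coord p x = 0 := by
  rw [LieModule.lowerCentralSeries_succ, ← LieSubmodule.mem_toSubmodule,
    LieSubmodule.lieIdeal_oper_eq_linear_span'] at hx
  induction hx using Submodule.span_induction with
  | zero => simp
  | add x y _ _ h h' => rw [map_add, h, h', add_zero]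
  | smul r x _ h => rw [map_smul, h, smul_zero]
  | mem x hx => obtain ⟨y, -, z, -, rfl⟩ := hx; exact coord_lie p y z

lemma nilLie_lowerCentralSeries_three :
    LieModule.lowerCentralSeries ℚ NilLie NilLie 3 = ⊥ := by
  rw [← le_bot_iff, ← LieSubmodule.ucs_eq_top_iff, eq_top_iff]
  intro a _
  simp only [LieSubmodule.ucs_succ, LieSubmodule.ucs_zero, LieSubmodule.mem_normalizer]
  intro b c d
  rw [LieSubmodule.mem_bot]
  have h : ∀ x y z : NilLie, ⁅x, ⁅y, ⁅z, a⁆⁆⁆ = 0 := by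
    intro x y z
    rw [← lie_skew z a, lie_neg, lie_neg, ← lie_skew y, lie_neg, ← lie_skew x, nilLie_class]
    simp
  exact h _ _ _

end Functionals

/-! ### The lower central series of `R` and of `H`. -/

section Commutator

variable {M : Type*} [LieRing M] [LieAlgebra ℚ M]

/-- The group commutator, for the Baker-Campbell-Hausdorff product in class three. -/
lemma bch_commutator (h : ∀ a b c d : M, ⁅⁅⁅a, b⁆, c⁆, d⁆ = 0) (x y : M) :
    bch (bch (bch x y) (-x)) (-y) =
      ⁅x, y⁆ - (1 / 2 : ℚ) • ⁅⁅x, y⁆, x⁆ - (1 / 2 : ℚ) • ⁅⁅x, y⁆, y⁆ := by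
  have h' : ∀ a b c d : M, ⁅d, ⁅⁅a, b⁆, c⁆⁆ = 0 := fun a b c d => by
    rw [← lie_skew, h, neg_zero]
  have h'' : ∀ a b c d : M, ⁅⁅a, b⁆, ⁅c, d⁆⁆ = 0 := fun a b c d => by
    rw [leibniz_lie, h, ← lie_skew c, h, neg_zero, add_zero]
  simp only [bch, add_lie, lie_add, sub_lie, lie_sub, smul_lie, lie_smul, h, h', h'', lie_neg,
    neg_lie, lie_self, zero_lie, lie_zero,
    smul_zero, add_zero, sub_zero]
  have e2 : ⁅y, x⁆ = -⁅x, y⁆ := (lie_skew y x).symm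
  simp only [e2, neg_lie, smul_neg]
  module

end Commutator

section ExampleGroup

open scoped commutatorElement

namespace ExampleGroup

lemma toNil_mul (x y : ExampleGroup) : (x * y).toNil = bch x.toNil y.toNil := rfl

lemma toNil_inv (x : ExampleGroup) : (x⁻¹).toNil = -x.toNil := rfl

lemma toNil_one : (1 : ExampleGroup).toNil = 0 := rfl

lemma toNil_injective {x y : ExampleGroup} (h : x.toNil = y.toNil) : x = y := h

lemma toNil_commutator (x y : ExampleGroup) : (⁅x, y⁆ : ExampleGroup).toNil =
    ⁅x.toNil, y.toNil⁆ - (1 / 2 : ℚ) • ⁅⁅x.toNil, y.toNil⁆, x.toNil⁆ -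
      (1 / 2 : ℚ) • ⁅⁅x.toNil, y.toNil⁆, y.toNil⁆ :=
  bch_commutator nilLie_class _ _

lemma toNil_pow (x : ExampleGroup) (n : ℕ) : (x ^ n).toNil = (n : ℚ) • x.toNil := by
  induction n with
  | zero => simp [toNil_one]
  | succ n ih =>
    rw [pow_succ, toNil_mul, ih, bch]
    simp only [smul_lie, lie_self, smul_zero, zero_lie, add_zero, sub_zero]
    push_cast
    module

lemma coord_mul (p : Fin 4) (x y : ExampleGroup) :
    coord p (x * y).toNil = coord p x.toNil + coord p y.toNil := by
  rw [toNil_mul, bch]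
  simp only [map_add, map_sub, map_smul, coord_lie, smul_zero, add_zero, sub_zero]

/-- The subgroup of `R` whose underlying set is a term of the lower central series of `L`. -/
noncomputable def lieSeries (k : ℕ) : Subgroup ExampleGroup where
  carrier := {x | x.toNil ∈ LieModule.lowerCentralSeries ℚ NilLie NilLie k}
  one_mem' := zero_mem (LieModule.lowerCentralSeries ℚ NilLie NilLie k)
  mul_mem' := by
    intro x y hx hy
    change bch x.toNil y.toNil ∈ LieModule.lowerCentralSeries ℚ NilLie NilLie k
    have h1 : ⁅x.toNil, y.toNil⁆ ∈ LieModule.lowerCentralSeries ℚ NilLie NilLie k :=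
      LieSubmodule.lie_mem _ hy
    have h2 : ∀ z : NilLie, ⁅⁅x.toNil, y.toNil⁆, z⁆ ∈
        LieModule.lowerCentralSeries ℚ NilLie NilLie k := fun z => by
      rw [← lie_skew]
      exact neg_mem (LieSubmodule.lie_mem _ h1)
    exact sub_mem (add_mem (add_mem (add_mem hx hy) (SMulMemClass.smul_mem _ h1))
      (SMulMemClass.smul_mem _ (h2 _))) (SMulMemClass.smul_mem _ (h2 _))
  inv_mem' := by
    intro x hx
    have h : x.toNil ∈ LieModule.lowerCentralSeries ℚ NilLie NilLie k := hx
    exact neg_mem h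

lemma lowerCentralSeries_le (k : ℕ) :
    (⊤ : Subgroup ExampleGroup).lowerCentralSeries k ≤ lieSeries k := by
  induction k with
  | zero => exact fun x _ => LieSubmodule.mem_top (R := ℚ) (L := NilLie) (M := NilLie) x.toNil
  | succ k ih =>
    rw [Subgroup.lowerCentralSeries_succ, Subgroup.commutator_le]
    intro x hx y _
    change (⁅x, y⁆ : ExampleGroup).toNil ∈ LieModule.lowerCentralSeries ℚ NilLie NilLie _
    have h1 : ⁅x.toNil, y.toNil⁆ ∈ LieModule.lowerCentralSeries ℚ NilLie NilLie (k + 1) := by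
      rw [← lie_skew, LieModule.lowerCentralSeries_succ]
      exact neg_mem (LieSubmodule.lie_mem_lie (LieSubmodule.mem_top _) (ih hx))
    have h2 : ∀ z : NilLie, ⁅⁅x.toNil, y.toNil⁆, z⁆ ∈
        LieModule.lowerCentralSeries ℚ NilLie NilLie (k + 1) := fun z => by
      rw [← lie_skew]
      exact neg_mem (LieSubmodule.lie_mem _ h1)
    rw [toNil_commutator]
    exact sub_mem (sub_mem h1 (SMulMemClass.smul_mem _ (h2 _))) (SMulMemClass.smul_mem _ (h2 _))

end ExampleGroup

lemma exampleH_lowerCentralSeries_le (k : ℕ) {x : exampleH}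
    (hx : x ∈ (⊤ : Subgroup exampleH).lowerCentralSeries k) :
    (x : ExampleGroup).toNil ∈ LieModule.lowerCentralSeries ℚ NilLie NilLie k := by
  have h1 := Subgroup.mem_map_of_mem exampleH.subtype hx
  rw [Subgroup.top_subtype_lowerCentralSeries] at h1
  exact ExampleGroup.lowerCentralSeries_le k (Subgroup.lowerCentralSeries_mono k le_top h1)

lemma exampleH_lowerCentralSeries_three :
    (⊤ : Subgroup exampleH).lowerCentralSeries 3 = ⊥ := by
  rw [eq_bot_iff]
  intro x hx
  have h := exampleH_lowerCentralSeries_le 3 hx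
  rw [nilLie_lowerCentralSeries_three, LieSubmodule.mem_bot] at h
  exact Subtype.ext (ExampleGroup.toNil_injective h)

/-- The generator `y_{i+1}` of `H`. -/
noncomputable def genH (i : Fin 4) : exampleH :=
  ⟨ExampleGroup.ofLie (genY i), Subgroup.subset_closure ⟨i, rfl⟩⟩

lemma toNil_genH (i : Fin 4) : (genH i : ExampleGroup).toNil = genN i := rfl

lemma closure_genH : Subgroup.closure (Set.range genH) = ⊤ := by
  refine Eq.trans ?_ (Subgroup.closure_closure_coe_preimage
    (k := Set.range fun i => ExampleGroup.ofLie (genY i)))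
  congr 1
  ext ⟨x, hx⟩
  exact exists_congr fun i => Subtype.ext_iff

/-- The relation of `L` passes to the group without change: every correction term in the
Baker-Campbell-Hausdorff commutators involved is a bracket of length at least four, once `[y_1,
y_2]` is rewritten as a triple bracket. -/
lemma commutator_genH_mem : ⁅genH 0, genH 1⁆ ∈ (⊤ : Subgroup exampleH).lowerCentralSeries 2 := by
  have h : ⁅genH 0, genH 1⁆ = ⁅⁅genH 2, genH 3⁆, genH 2⁆⁻¹ := by
    refine Subtype.ext (ExampleGroup.toNil_injective ?_)
    change (⁅(genH 0 : ExampleGroup), (genH 1 : ExampleGroup)⁆ : ExampleGroup).toNil =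
      -(⁅⁅(genH 2 : ExampleGroup), (genH 3 : ExampleGroup)⁆, (genH 2 : ExampleGroup)⁆ :
        ExampleGroup).toNil
    simp only [ExampleGroup.toNil_commutator, toNil_genH, genN_relation, sub_lie, smul_lie, neg_lie,
      nilLie_class, smul_zero, sub_zero, neg_zero]
  rw [h]
  exact inv_mem (Subgroup.commutator_mem_commutator
    (Subgroup.commutator_mem_commutator (Subgroup.mem_top _) (Subgroup.mem_top _))
    (Subgroup.mem_top _))

end ExampleGroup
end MagnusLie

namespace MagnusLie

/-! ### Torsion-free lower central factors: `H` is a Magnus group. -/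

section TorsionFree

open scoped commutatorElement

variable {G : Type*} [Group G]

/-- A criterion for `A / B` to be torsion-free: it is generated by elements with a dual family of
functionals. -/
lemma mem_of_pow_mem {ι : Type*} [Finite ι] [DecidableEq ι] {A B : Subgroup G} [B.Normal]
    (hBA : B ≤ A) (hab : ∀ x ∈ A, ∀ y ∈ A, ⁅x, y⁆ ∈ B) (s : ι → G) (hs : ∀ i, s i ∈ A)
    (hA : A ≤ Subgroup.closure (Set.range s) ⊔ B) (θ : ι → G → ℚ)
    (hθ : ∀ i, ∀ x ∈ A, ∀ y ∈ A, θ i (x * y) = θ i x + θ i y) (hB : ∀ i, ∀ x ∈ B, θ i x = 0)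
    (hdual : ∀ i j, θ i (s j) = if i = j then 1 else 0) {x : G} (hx : x ∈ A) {n : ℕ} (hn : n ≠ 0)
    (hxn : x ^ n ∈ B) : x ∈ B := by
  cases nonempty_fintype ι
  let C := B.subgroupOf A
  let _ : CommGroup (A ⧸ C) :=
    { (inferInstance : Group (A ⧸ C)) with
      mul_comm := by
        intro a b
        obtain ⟨a, rfl⟩ := QuotientGroup.mk'_surjective C a
        obtain ⟨b, rfl⟩ := QuotientGroup.mk'_surjective C b
        rw [← map_mul, ← map_mul]
        refine QuotientGroup.eq.2 ?_
        have := hab _ (inv_mem b.2) _ (inv_mem a.2)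
        rw [Subgroup.mem_subgroupOf]
        simpa [commutatorElement_def, mul_assoc] using this }
  let π : A →* A ⧸ C := QuotientGroup.mk' C
  let t : ι → A ⧸ C := fun i => π ⟨s i, hs i⟩
  have hcl : ∀ a : A, π a ∈ Subgroup.closure (Set.range t) := by
    have h1 : Subgroup.closure (Set.range s) ⊔ B ≤
        ((Subgroup.closure (Set.range t)).comap π).map A.subtype := by
      refine sup_le ((Subgroup.closure_le _).2 ?_) fun b hb => ?_
      · rintro _ ⟨i, rfl⟩
        exact ⟨⟨s i, hs i⟩, Subgroup.subset_closure ⟨i, rfl⟩, rfl⟩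
      · have h1 : π ⟨b, hBA hb⟩ = 1 := (QuotientGroup.eq_one_iff _).2 hb
        have h2 : π ⟨b, hBA hb⟩ ∈ Subgroup.closure (Set.range t) := h1 ▸ one_mem _
        exact ⟨⟨b, hBA hb⟩, h2, rfl⟩
    intro a
    obtain ⟨b, hb, hba⟩ := h1 (hA a.2)
    obtain rfl : b = a := Subtype.ext hba
    exact hb
  let φ : ι → (A →* Multiplicative ℚ) := fun i =>
    { toFun := fun a => Multiplicative.ofAdd (θ i a)
      map_one' := by
        have := hθ i 1 (one_mem _) 1 (one_mem _)
        rw [mul_one] at this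
        change θ i 1 = 0
        linarith
      map_mul' := fun a b => congrArg Multiplicative.ofAdd (hθ i a a.2 b b.2) }
  let Φ : ι → (A ⧸ C →* Multiplicative ℚ) := fun i =>
    QuotientGroup.lift C (φ i) fun a ha => congrArg Multiplicative.ofAdd (hB i a ha)
  -- Write the class of `x` as a product of powers of the `t j`. The functional `Φ i` reads off the
  -- exponent `e i`, and it vanishes on torsion because `ℚ` is torsion-free.
  obtain ⟨e, he⟩ := Subgroup.exists_of_mem_closure_range t _ (hcl ⟨x, hx⟩)
  have hΦ : ∀ i j, Φ i (t j) = Multiplicative.ofAdd (if i = j then 1 else 0) := fun i j =>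
    congrArg Multiplicative.ofAdd (hdual i j)
  have hn' : (π ⟨x, hx⟩) ^ n = 1 := by
    rw [← map_pow]
    exact (QuotientGroup.eq_one_iff _).2 hxn
  have he0 : ∀ i, e i = 0 := by
    intro i
    have h1 := congrArg (fun q => (Φ i q).toAdd) he
    have h2 := congrArg (fun q => (Φ i q).toAdd) hn'
    simp only [map_prod, map_zpow, hΦ, map_pow, map_one, toAdd_pow, toAdd_one, toAdd_prod,
      toAdd_zpow, toAdd_ofAdd] at h1 h2
    rw [nsmul_eq_mul, mul_eq_zero] at h2
    rw [h2.resolve_left (by exact_mod_cast hn)] at h1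
    simpa using h1.symm
  have h1 : π ⟨x, hx⟩ = 1 := by
    rw [he]
    exact Finset.prod_eq_one fun i _ => by rw [he0, zpow_zero]
  exact (QuotientGroup.eq_one_iff (N := C) ⟨x, hx⟩).1 h1

/-- If generators commute modulo a normal subgroup, then so do all elements. -/
lemma commutator_mem_of_closure {s : Set G} (hs : Subgroup.closure s = ⊤) (N : Subgroup G)
    [N.Normal] (h : ∀ a ∈ s, ∀ b ∈ s, ⁅a, b⁆ ∈ N) (x y : G) : ⁅x, y⁆ ∈ N := by
  have key : ∀ a b : G, ⁅a, b⁆ ∈ N ↔ Commute (QuotientGroup.mk' N a) (QuotientGroup.mk' N b) := by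
    intro a b
    rw [← commutatorElement_eq_one_iff_commute, ← map_commutatorElement]
    exact (QuotientGroup.eq_one_iff _).symm
  have h1 : ∀ b ∈ s, ∀ x : G, ⁅x, b⁆ ∈ N := by
    intro b hb x
    have : ⊤ ≤ (Subgroup.centralizer {QuotientGroup.mk' N b}).comap (QuotientGroup.mk' N) := by
      rw [← hs, Subgroup.closure_le]
      intro a ha
      exact Subgroup.mem_centralizer_singleton_iff.2 ((key a b).1 (h a ha b hb))
    rw [key]
    exact Subgroup.mem_centralizer_singleton_iff.1 (this (Subgroup.mem_top x))
  have : ⊤ ≤ (Subgroup.centralizer {QuotientGroup.mk' N x}).comap (QuotientGroup.mk' N) := by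
    rw [← hs, Subgroup.closure_le]
    intro a ha
    exact Subgroup.mem_centralizer_singleton_iff.2 ((key x a).1 (h1 a ha x)).symm
  rw [key]
  exact (Subgroup.mem_centralizer_singleton_iff.1 (this (Subgroup.mem_top y))).symm

end TorsionFree

section Magnus

open scoped commutatorElement

/-- The pairs `i < j` other than `(1, 2)`. -/
abbrev BracketIndex : Type := {p : Fin 4 × Fin 4 // p.1 < p.2 ∧ ¬(p.1 = 0 ∧ p.2 = 1)}

lemma exists_pairing_bracketIndex (p : BracketIndex) : ∃ ω : NilLie →ₗ[ℚ] ℚ,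
      (∀ x y : NilLie, ω ⁅x, y⁆ = coord p.1.1 x * coord p.1.2 y - coord p.1.1 y * coord p.1.2 x) ∧
      ∀ x ∈ LieModule.lowerCentralSeries ℚ NilLie NilLie 2, ω x = 0 :=
  exists_pairing p.2.2 fun h => by
    have := p.2.1
    rw [h.1, h.2] at this
    exact absurd this (by decide)

/-- The coordinates of an element of `γ_2(L)` modulo `γ_3(L)`. -/
noncomputable def pairing (p : BracketIndex) : NilLie →ₗ[ℚ] ℚ :=
  (exists_pairing_bracketIndex p).choose

lemma pairing_lie (p : BracketIndex) (x y : NilLie) :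
    pairing p ⁅x, y⁆ = coord p.1.1 x * coord p.1.2 y - coord p.1.1 y * coord p.1.2 x :=
  (exists_pairing_bracketIndex p).choose_spec.1 x y

lemma pairing_eq_zero (p : BracketIndex) {x : NilLie}
    (hx : x ∈ LieModule.lowerCentralSeries ℚ NilLie NilLie 2) : pairing p x = 0 :=
  (exists_pairing_bracketIndex p).choose_spec.2 x hx

lemma pairing_commutator (p : BracketIndex) (x y : ExampleGroup) :
    pairing p (⁅x, y⁆ : ExampleGroup).toNil =
      coord p.1.1 x.toNil * coord p.1.2 y.toNil - coord p.1.1 y.toNil * coord p.1.2 x.toNil := by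
  simp only [ExampleGroup.toNil_commutator, map_sub, map_smul, pairing_lie, coord_lie, zero_mul,
    mul_zero, sub_zero, smul_zero]

lemma pairing_mul (p : BracketIndex) {x y : ExampleGroup} (hx : ∀ i, coord i x.toNil = 0) :
    pairing p (x * y).toNil = pairing p x.toNil + pairing p y.toNil := by
  simp only [ExampleGroup.toNil_mul, bch, map_sub, map_add, map_smul, pairing_lie, coord_lie,
    zero_mul, mul_zero, sub_zero, smul_zero, hx, add_zero]

lemma pairing_commutator_genH (p q : BracketIndex) :
    pairing p (⁅(genH q.1.1 : ExampleGroup), (genH q.1.2 : ExampleGroup)⁆ : ExampleGroup).toNil =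
      if p = q then 1 else 0 := by
  rw [pairing_commutator]
  simp only [toNil_genH, coord_genN]
  -- A finite check, stated over `ℤ` so that evaluation decides it.
  have h : ∀ p q : BracketIndex,
      (((if q.1.1 = p.1.1 then 1 else 0) * (if q.1.2 = p.1.2 then 1 else 0) -
        (if q.1.2 = p.1.1 then 1 else 0) * (if q.1.1 = p.1.2 then 1 else 0) : ℤ)) =
      if p = q then 1 else 0 := by decide
  exact_mod_cast h p q

/-- The pair `(1, 2)` may be left out of the generators because its commutator already lies in
`γ_3`. This matches the pairs for which dual functionals exist. -/
lemma lowerCentralSeries_one_le : (⊤ : Subgroup exampleH).lowerCentralSeries 1 ≤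
    Subgroup.closure (Set.range fun p : BracketIndex => ⁅genH p.1.1, genH p.1.2⁆) ⊔
      (⊤ : Subgroup exampleH).lowerCentralSeries 2 := by
  set N := Subgroup.closure (Set.range fun p : BracketIndex => ⁅genH p.1.1, genH p.1.2⁆) ⊔
      (⊤ : Subgroup exampleH).lowerCentralSeries 2 with hN
  have hN1 : N ≤ (⊤ : Subgroup exampleH).lowerCentralSeries 1 := by
    refine sup_le ((Subgroup.closure_le _).2 ?_) (Subgroup.lowerCentralSeries_antitone _ (by omega))
    rintro _ ⟨p, rfl⟩
    exact Subgroup.commutator_mem_commutator (Subgroup.mem_top _) (Subgroup.mem_top _)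
  -- `N` lies between `γ_3` and `γ_2`, so conjugation alters its elements by factors from `γ_3`,
  -- which `N` contains.
  have : N.Normal := ⟨fun n hn g => by
    have h1 : ⁅n, g⁆ ∈ (⊤ : Subgroup exampleH).lowerCentralSeries 2 :=
      Subgroup.commutator_mem_commutator (hN1 hn) (Subgroup.mem_top g)
    have h2 : g * n * g⁻¹ = ⁅n, g⁆⁻¹ * n := by simp [commutatorElement_def, mul_assoc]
    rw [h2]
    exact mul_mem (inv_mem (le_sup_right (a := Subgroup.closure _) h1)) hn⟩
  rw [Subgroup.lowerCentralSeries_succ, Subgroup.commutator_le]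
  intro x _ y _
  refine commutator_mem_of_closure closure_genH N ?_ x y
  have key : ∀ i j : Fin 4, i < j → ⁅genH i, genH j⁆ ∈ N := by
    intro i j hij
    by_cases h : i = 0 ∧ j = 1
    · rw [h.1, h.2]
      exact le_sup_right (a := Subgroup.closure _) commutator_genH_mem
    · exact le_sup_left (b := (⊤ : Subgroup exampleH).lowerCentralSeries 2)
        (Subgroup.subset_closure ⟨⟨(i, j), hij, h⟩, rfl⟩)
  rintro _ ⟨i, rfl⟩ _ ⟨j, rfl⟩
  rcases lt_trichotomy i j with h | rfl | h
  · exact key i j h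
  · rw [commutatorElement_self]; exact one_mem _
  · rw [← commutatorElement_inv]; exact inv_mem (key j i h)

/-- The first two factors have dual functionals, the coordinates and the pairings. In `γ_3` an
element with a trivial power is trivial because `n`-th powers in `R` are multiples by `n` in a
rational vector space. -/
lemma lowerCentralSeries_isolated (k : ℕ) {x : exampleH}
    (hx : x ∈ (⊤ : Subgroup exampleH).lowerCentralSeries k) {n : ℕ} (hn : n ≠ 0)
    (hxn : x ^ n ∈ (⊤ : Subgroup exampleH).lowerCentralSeries (k + 1)) :
    x ∈ (⊤ : Subgroup exampleH).lowerCentralSeries (k + 1) := by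
  have hcomm : ∀ k, ∀ x ∈ (⊤ : Subgroup exampleH).lowerCentralSeries k,
      ∀ y ∈ (⊤ : Subgroup exampleH).lowerCentralSeries k,
      ⁅x, y⁆ ∈ (⊤ : Subgroup exampleH).lowerCentralSeries (k + 1) := fun k x hx y hy =>
    Subgroup.commutator_mem_commutator hx (Subgroup.mem_top y)
  have hanti : ∀ k, (⊤ : Subgroup exampleH).lowerCentralSeries (k + 1) ≤
      (⊤ : Subgroup exampleH).lowerCentralSeries k := fun k =>
    Subgroup.lowerCentralSeries_antitone _ (by omega)
  have hcoord : ∀ x ∈ (⊤ : Subgroup exampleH).lowerCentralSeries 1, ∀ i,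
      coord i (x : ExampleGroup).toNil = 0 := fun x hx i =>
    coord_eq_zero_of_mem i (exampleH_lowerCentralSeries_le 1 hx)
  match k with
  | 0 =>
    refine mem_of_pow_mem (hanti 0) (hcomm 0) genH (fun i => Subgroup.mem_top _) ?_
      (fun i x => coord i (x : ExampleGroup).toNil) (fun i x _ y _ => ExampleGroup.coord_mul i x y)
      (fun i x hx => hcoord x hx i) (fun i j => ?_) hx hn hxn
    · rw [closure_genH, top_sup_eq]; exact le_top
    · rw [toNil_genH, coord_genN]
      exact if_congr eq_comm rfl rfl
  | 1 =>
    exact mem_of_pow_mem (hanti 1) (hcomm 1) (fun p : BracketIndex => ⁅genH p.1.1, genH p.1.2⁆)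
      (fun p => hcomm 0 _ (Subgroup.mem_top _) _ (Subgroup.mem_top _)) lowerCentralSeries_one_le
      (fun p x => pairing p (x : ExampleGroup).toNil)
      (fun p x hx y _ => pairing_mul p (hcoord x hx))
      (fun p x hx => pairing_eq_zero p (exampleH_lowerCentralSeries_le 2 hx))
      pairing_commutator_genH hx hn hxn
  | 2 =>
    rw [exampleH_lowerCentralSeries_three] at hxn ⊢
    have h1 : ((x : ExampleGroup) ^ n).toNil = 0 :=
      congrArg (fun y : exampleH => (y : ExampleGroup).toNil) (Subgroup.mem_bot.1 hxn)
    rw [ExampleGroup.toNil_pow, smul_eq_zero] at h1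
    exact Subgroup.mem_bot.2 (Subtype.ext (ExampleGroup.toNil_injective
      (h1.resolve_left (by exact_mod_cast hn))))
  | k + 3 =>
    have h1 := Subgroup.lowerCentralSeries_antitone (⊤ : Subgroup exampleH)
      (show 3 ≤ k + 3 by omega) hx
    rw [exampleH_lowerCentralSeries_three, Subgroup.mem_bot] at h1
    rw [h1]
    exact one_mem _

lemma exampleH_isMagnus : IsMagnus exampleH := by
  constructor
  · intro i q n hn hq
    obtain ⟨x, rfl⟩ := QuotientGroup.mk'_surjective _ q
    rw [← map_pow] at hq
    have h1 := (QuotientGroup.eq_one_iff _).1 hq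
    refine (QuotientGroup.eq_one_iff _).2 ?_
    rw [Subgroup.mem_subgroupOf] at h1 ⊢
    have hi : ((i + 1 : ℕ+) : ℕ) - 1 = (i : ℕ) - 1 + 1 := by
      have := i.pos
      rw [PNat.add_coe, PNat.one_coe]; omega
    have h2 := x.2
    unfold gamma at h1 h2 ⊢
    rw [hi] at h1 ⊢
    exact lowerCentralSeries_isolated _ h2 hn h1
  · rw [eq_bot_iff]
    -- `γ_4` is the term of index 3.
    refine (iInf_le _ 4).trans ?_
    exact exampleH_lowerCentralSeries_three.le

end Magnus

/-! ### `H` is not relatively free. -/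

section RelativelyFree

open scoped commutatorElement

/-- A relatively free group has generators whose values under an endomorphism are arbitrary. -/
lemma IsRelativelyFree.exists_generators.{u} {G : Type u} [Group G] (h : IsRelativelyFree G) :
    ∃ (X : Type u) (s : X → G), Subgroup.closure (Set.range s) = ⊤ ∧
      ∀ t : X → G, ∃ φ : G →* G, ∀ x, φ (s x) = t x := by
  obtain ⟨X, W, ⟨e⟩⟩ := h
  let π : FreeGroup X →* G := e.symm.toMonoidHom.comp (QuotientGroup.mk' (verbalSubgroup W _))
  have hπ : Function.Surjective π := e.symm.surjective.comp (QuotientGroup.mk'_surjective _)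
  have hker : ∀ w ∈ verbalSubgroup W (FreeGroup X), π w = 1 := by
    intro w hw
    change e.symm _ = 1
    rw [map_eq_one_iff _ e.symm.injective]
    exact (QuotientGroup.eq_one_iff _).2 hw
  refine ⟨X, fun x => π (FreeGroup.of x), ?_, fun t => ?_⟩
  · have : Set.range (fun x => π (FreeGroup.of x)) = π '' Set.range FreeGroup.of :=
      Set.range_comp π FreeGroup.of
    rw [this, ← MonoidHom.map_closure, FreeGroup.closure_range_of]
    exact Subgroup.map_top_of_surjective π hπ
  · let f : FreeGroup X →* G := FreeGroup.lift t
    have hf : verbalSubgroup W (FreeGroup X) ≤ f.ker := by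
      refine (Subgroup.closure_le _).2 ?_
      rintro _ ⟨w, hw, ψ, rfl⟩
      -- Values of `f ∘ ψ` lift through `π`, so `f (ψ w)` is the image under `π` of another value of
      -- the law `w`, hence trivial.
      choose c hc using fun n => hπ (f (ψ (FreeGroup.of n)))
      have h1 : f.comp ψ = π.comp (FreeGroup.lift c) := by
        ext n
        simp [hc]
      have h2 : f (ψ w) = π (FreeGroup.lift c w) := DFunLike.congr_fun h1 w
      rw [SetLike.mem_coe, MonoidHom.mem_ker, h2]
      exact hker _ (Subgroup.subset_closure ⟨w, hw, _, rfl⟩)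
    refine ⟨(QuotientGroup.lift _ f hf).comp e.toMonoidHom, fun x => ?_⟩
    have : e (π (FreeGroup.of x)) = QuotientGroup.mk' _ (FreeGroup.of x) := e.apply_symm_apply _
    change QuotientGroup.lift _ f hf (e (π (FreeGroup.of x))) = t x
    rw [this]
    simp [f]

/-- Integrality allows coordinates of elements of `H` to serve as exponents inside `H`. -/
lemma exists_int_coord (p : Fin 4) (x : exampleH) :
    ∃ n : ℤ, coord p (x : ExampleGroup).toNil = n := by
  have hx : x ∈ Subgroup.closure (Set.range genH) := closure_genH ▸ Subgroup.mem_top x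
  induction hx using Subgroup.closure_induction with
  | mem x hx =>
    obtain ⟨i, rfl⟩ := hx
    refine ⟨if i = p then 1 else 0, ?_⟩
    rw [toNil_genH, coord_genN]
    push_cast
    rfl
  | one => exact ⟨0, by rw [Subgroup.coe_one, ExampleGroup.toNil_one]; simp⟩
  | mul x y _ _ hx hy =>
    obtain ⟨m, hm⟩ := hx
    obtain ⟨n, hn⟩ := hy
    exact ⟨m + n, by rw [Subgroup.coe_mul, ExampleGroup.coord_mul, hm, hn]; push_cast; rfl⟩
  | inv x _ hx =>
    obtain ⟨m, hm⟩ := hx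
    exact ⟨-m, by rw [Subgroup.coe_inv, ExampleGroup.toNil_inv, map_neg, hm]; push_cast; rfl⟩

/-- The coordinates of an element of `H` modulo `γ_2(H)`. -/
noncomputable def coordHom (p : Fin 4) : exampleH →* Multiplicative ℚ where
  toFun x := Multiplicative.ofAdd (coord p (x : ExampleGroup).toNil)
  map_one' := by
    change coord p (1 : ExampleGroup).toNil = 0
    rw [ExampleGroup.toNil_one, map_zero]
  map_mul' x y := ExampleGroup.coord_mul p x y

lemma coordHom_genH (p i : Fin 4) :
    coordHom p (genH i) = Multiplicative.ofAdd (if i = p then 1 else 0) :=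
  congrArg Multiplicative.ofAdd (coord_genN p i)

lemma exampleH_not_isRelativelyFree : ¬ IsRelativelyFree exampleH := by
  intro h
  obtain ⟨X, s, hs, hext⟩ := h.exists_generators
  choose a ha using fun x => exists_int_coord 0 (s x)
  choose b hb using fun x => exists_int_coord 1 (s x)
  -- The free generators `s` are unknown, but prescribing these images makes the last two
  -- coordinates of `φ g` equal to the first two of `g`, on generators and hence everywhere.
  obtain ⟨φ, hφ⟩ := hext fun x => genH 2 ^ a x * genH 3 ^ b x
  have key : ∀ (p q : Fin 4), (∀ x, coordHom p (φ (s x)) = coordHom q (s x)) →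
      ∀ g, coordHom p (φ g) = coordHom q g := by
    intro p q h
    have : (coordHom p).comp φ = coordHom q :=
      MonoidHom.eq_of_eqOn_dense hs (by rintro _ ⟨x, rfl⟩; exact h x)
    exact DFunLike.congr_fun this
  have h2 := key 2 0 fun x => by
    rw [hφ, map_mul, map_zpow, map_zpow, coordHom_genH, coordHom_genH]
    change a x • (1 : ℚ) + b x • (0 : ℚ) = coord 0 _
    rw [ha]; simp
  have h3 := key 3 1 fun x => by
    rw [hφ, map_mul, map_zpow, map_zpow, coordHom_genH, coordHom_genH]
    change a x • (0 : ℚ) + b x • (1 : ℚ) = coord 1 _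
    rw [hb]; simp
  have hc2 : ∀ g : exampleH, coord 2 (φ g : ExampleGroup).toNil =
    coord 0 (g : ExampleGroup).toNil := h2
  have hc3 : ∀ g : exampleH, coord 3 (φ g : ExampleGroup).toNil =
    coord 1 (g : ExampleGroup).toNil := h3
  have hmem : ⁅φ (genH 0), φ (genH 1)⁆ ∈ (⊤ : Subgroup exampleH).lowerCentralSeries 2 := by
    rw [← map_commutatorElement]
    have h4 := Subgroup.mem_map_of_mem φ commutator_genH_mem
    rw [Subgroup.map_lowerCentralSeries] at h4
    exact Subgroup.lowerCentralSeries_mono 2 le_top h4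
  -- The pairing for `(y_3, y_4)` vanishes on `γ_3`, yet on this commutator it equals the minor 1 ·
  -- 1 - 0 · 0.
  have h5 := pairing_eq_zero ⟨(2, 3), by decide⟩ (exampleH_lowerCentralSeries_le 2 hmem)
  have h6 := pairing_commutator ⟨(2, 3), by decide⟩ (φ (genH 0)) (φ (genH 1))
  rw [hc2, hc2, hc3, hc3] at h6
  simp only [toNil_genH, coord_genN] at h6
  have h7 := h6.symm.trans h5
  norm_num at h7

end RelativelyFree
end MagnusLie

namespace MagnusLie

/-! ### Commuting elements of the logarithmic Lie algebra are proportional modulo brackets. -/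

section Detecting

attribute [local instance 100] LieRing.ofAssociativeRing

/-- The weights of the five-dimensional representation of `L`. -/
def fiveWeight : Fin 5 → ℕ := ![0, 1, 2, 3, 1]

lemma lie_apply_five {M N : Matrix (Fin 5) (Fin 5) ℚ} (hM : M ∈ weightFiltration fiveWeight 1)
    (hN : N ∈ weightFiltration fiveWeight 1) :
    ⁅M, N⁆ 0 3 = M 0 1 * N 1 3 + M 0 2 * N 2 3 + M 0 4 * N 4 3 -
      (N 0 1 * M 1 3 + N 0 2 * M 2 3 + N 0 4 * M 4 3) ∧
    ⁅M, N⁆ 4 3 = M 4 2 * N 2 3 - N 4 2 * M 2 3 := by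
  have h : ∀ {M : Matrix (Fin 5) (Fin 5) ℚ}, M ∈ weightFiltration fiveWeight 1 →
      M 0 0 = 0 ∧ M 3 3 = 0 ∧ M 4 0 = 0 ∧ M 4 1 = 0 ∧ M 4 4 = 0 := fun h =>
    ⟨h _ _ (by decide), h _ _ (by decide), h _ _ (by decide), h _ _ (by decide), h _ _ (by decide)⟩
  obtain ⟨h1, h2, h3, h4, h5⟩ := h hM
  obtain ⟨h1', h2', h3', h4', h5'⟩ := h hN
  simp only [LieRing.of_associative_ring_bracket, Matrix.sub_apply, Matrix.mul_apply,
    Fin.sum_univ_five, h1, h2, h3, h4, h5, h1', h2', h3', h4', h5']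
  constructor <;> ring

/-- A representation of `L` in which `[y_1, y_2]` does not vanish. -/
lemma exists_five : ∃ ρ : NilLie →ₗ⁅ℚ⁆ Matrix (Fin 5) (Fin 5) ℚ,
    (∀ x, ρ x ∈ weightFiltration fiveWeight 1) ∧ ∀ x, ρ x 0 4 = coord 0 x ∧ ρ x 4 3 = coord 1 x ∧
      ρ x 0 1 = coord 2 x ∧ ρ x 2 3 = coord 3 x := by
  -- Two paths lead from 0 to 3: through 4, giving `[Y 0, Y 1] = E₀₃`, and through 1 and 2, giving
  -- `[Y 2, Y 3] = E₁₃` and `[[Y 2, Y 3], Y 2] = -E₀₃`. The relator therefore acts by zero, while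
  -- `[y_1, y_2]` does not.
  let Y : Fin 4 → Matrix (Fin 5) (Fin 5) ℚ := ![
    !![0, 0, 0, 0, 1; 0, 0, 0, 0, 0; 0, 0, 0, 0, 0; 0, 0, 0, 0, 0; 0, 0, 0, 0, 0],
    !![0, 0, 0, 0, 0; 0, 0, 0, 0, 0; 0, 0, 0, 0, 0; 0, 0, 0, 0, 0; 0, 0, 0, 1, 0],
    !![0, 1, 0, 0, 0; 0, 0, 1, 0, 0; 0, 0, 0, 0, 0; 0, 0, 0, 0, 0; 0, 0, 0, 0, 0],
    !![0, 0, 0, 0, 0; 0, 0, 0, 0, 0; 0, 0, 0, 1, 0; 0, 0, 0, 0, 0; 0, 0, 0, 0, 0]]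
  have hY : ∀ i, Y i ∈ weightFiltration fiveWeight 1 := by
    intro i j k
    fin_cases i <;> fin_cases j <;> fin_cases k <;> simp [Y, fiveWeight]
  obtain ⟨ρ, hρ, hρ'⟩ := exists_representation (d := fiveWeight) (by decide) Y hY (by
    ext i j
    fin_cases i <;> fin_cases j <;>
      simp [Y, LieRing.of_associative_ring_bracket])
  refine ⟨ρ, hρ', fun x => ?_⟩
  -- The weights allow brackets a nonzero entry (4, 3). Carrying along the vanishing of the entry
  -- (4, 2) excludes it, so that the entry (4, 3) is a coordinate.
  let K : LieSubalgebra ℚ NilLie :=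
    { carrier := {x | ρ x 4 2 = 0 ∧ ρ x 0 4 = coord 0 x ∧ ρ x 4 3 = coord 1 x ∧
        ρ x 0 1 = coord 2 x ∧ ρ x 2 3 = coord 3 x}
      zero_mem' := by simp
      add_mem' := by
        rintro x y ⟨h1, h2, h3, h4, h5⟩ ⟨h1', h2', h3', h4', h5'⟩
        simp [h1, h2, h3, h4, h5, h1', h2', h3', h4', h5']
      smul_mem' := by
        rintro r x ⟨h1, h2, h3, h4, h5⟩
        simp [h1, h2, h3, h4, h5]
      lie_mem' := by
        rintro x y ⟨h1, -⟩ ⟨h1', -⟩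
        have h2 := lie_mem_weightFiltration (hρ' x) (hρ' y)
        have h3 := (lie_apply_five (hρ' x) (hρ' y)).2
        rw [h1, h1', zero_mul, zero_mul, sub_zero] at h3
        change ρ ⁅x, y⁆ 4 2 = 0 ∧ ρ ⁅x, y⁆ 0 4 = coord 0 ⁅x, y⁆ ∧ ρ ⁅x, y⁆ 4 3 = coord 1 ⁅x, y⁆ ∧
          ρ ⁅x, y⁆ 0 1 = coord 2 ⁅x, y⁆ ∧ ρ ⁅x, y⁆ 2 3 = coord 3 ⁅x, y⁆
        simp only [LieHom.map_lie, coord_lie]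
        exact ⟨h2 _ _ (by decide), h2 _ _ (by decide), h3, h2 _ _ (by decide), h2 _ _ (by decide)⟩ }
  refine (nilLie_mem K (fun i => ?_) x).2
  change ρ (genN i) 4 2 = 0 ∧ ρ (genN i) 0 4 = coord 0 (genN i) ∧ ρ (genN i) 4 3 = coord 1 (genN i) ∧
    ρ (genN i) 0 1 = coord 2 (genN i) ∧ ρ (genN i) 2 3 = coord 3 (genN i)
  simp only [hρ, coord_genN]
  fin_cases i <;> simp [Y]

variable {M : Type*} [LieRing M] [LieAlgebra ℚ M] {ℓ : exampleH → M}

/-- The representations of `L` extend along `ℓ` to `M`. -/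
def ExtendsRepresentations (ℓ : exampleH → M) : Prop :=
  ∀ (n : ℕ) (d : Fin n → ℕ), (∀ i, d i < 4) → ∀ ρ : NilLie →ₗ⁅ℚ⁆ Matrix (Fin n) (Fin n) ℚ,
    (∀ x, ρ x ∈ weightFiltration d 1) → ∃ Φ : M →ₗ[ℚ] Matrix (Fin n) (Fin n) ℚ,
      (∀ x y : M, Φ ⁅x, y⁆ = ⁅Φ x, Φ y⁆) ∧
      ∀ g : exampleH, Φ (ℓ g) = ρ (g : ExampleGroup).toNil

lemma ExtendsRepresentations.exists_mem (hrep : ExtendsRepresentations ℓ)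
    (hspan : Submodule.span ℚ (Set.range ℓ) = ⊤) {n : ℕ} {d : Fin n → ℕ} (hd : ∀ i, d i < 4)
    (ρ : NilLie →ₗ⁅ℚ⁆ Matrix (Fin n) (Fin n) ℚ) (hρ : ∀ x, ρ x ∈ weightFiltration d 1) :
    ∃ Φ : M →ₗ[ℚ] Matrix (Fin n) (Fin n) ℚ, (∀ x y : M, Φ ⁅x, y⁆ = ⁅Φ x, Φ y⁆) ∧
      (∀ g : exampleH, Φ (ℓ g) = ρ (g : ExampleGroup).toNil) ∧ ∀ x, Φ x ∈ weightFiltration d 1 := by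
  obtain ⟨Φ, h1, h2⟩ := hrep n d hd ρ hρ
  refine ⟨Φ, h1, h2, fun x => ?_⟩
  have : ⊤ ≤ (weightFiltration d 1).comap Φ := by
    rw [← hspan, Submodule.span_le]
    rintro _ ⟨g, rfl⟩
    change Φ (ℓ g) ∈ weightFiltration d 1
    rw [h2]
    exact hρ _
  exact this (Submodule.mem_top (x := x))

lemma entry_eq {n : ℕ} (hspan : Submodule.span ℚ (Set.range ℓ) = ⊤)
    (Φ : M →ₗ[ℚ] Matrix (Fin n) (Fin n) ℚ) (α : M →ₗ[ℚ] ℚ) (i j : Fin n)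
    (h : ∀ g, Φ (ℓ g) i j = α (ℓ g)) (x : M) : Φ x i j = α x := by
  have : (Matrix.entryLinearMap ℚ ℚ i j).comp Φ = α :=
    LinearMap.ext_on_range hspan h
  exact LinearMap.congr_fun this x

lemma ExtendsRepresentations.exists_coord (hrep : ExtendsRepresentations ℓ) (p : Fin 4) :
    ∃ α : M →ₗ[ℚ] ℚ, ∀ g : exampleH, α (ℓ g) = coord p (g : ExampleGroup).toNil := by
  obtain ⟨ρ, hρ, h1, -⟩ := exists_heisenberg_coord (p := p) (q := p)
    (by rintro ⟨rfl, h⟩; exact absurd h (by decide)) (by rintro ⟨rfl, h⟩; exact absurd h (by decide))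
  obtain ⟨Φ, -, h⟩ := hrep 3 _ (fun i => by omega) ρ hρ
  exact ⟨(Matrix.entryLinearMap ℚ ℚ 0 1).comp Φ, fun g => by
    rw [← h1, ← h]; rfl⟩

/-- Commuting elements have proportional coordinates modulo brackets. -/
lemma coord_minor_eq_zero (hrep : ExtendsRepresentations ℓ)
    (hspan : Submodule.span ℚ (Set.range ℓ) = ⊤) (α : Fin 4 → M →ₗ[ℚ] ℚ)
    (hα : ∀ p g, α p (ℓ g) = coord p (g : ExampleGroup).toNil) {u v : M} (huv : ⁅u, v⁆ = 0)
    (p q : Fin 4) : α p u * α q v - α p v * α q u = 0 := by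
  have key : ∀ p q : Fin 4, ¬(p = 0 ∧ q = 1) → ¬(p = 1 ∧ q = 0) →
      α p u * α q v - α p v * α q u = 0 := by
    intro p q h h'
    obtain ⟨ρ, hρ, h1, h2⟩ := exists_heisenberg_coord h h'
    obtain ⟨Φ, hΦ, hΦℓ, hΦm⟩ := hrep.exists_mem hspan (fun i => by omega) ρ hρ
    have e1 := entry_eq hspan Φ (α p) 0 1 fun g => by rw [hΦℓ, hα, h1]
    have e2 := entry_eq hspan Φ (α q) 1 2 fun g => by rw [hΦℓ, hα, h2]
    have h3 := lie_apply_zero_two (hΦm u) (hΦm v)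
    rw [← hΦ, huv, map_zero, e1, e1, e2, e2] at h3
    exact h3.symm
  -- For the remaining minor `P`, the corner entry (0, 3) of the zero matrix `[Φ u, Φ v]` expresses
  -- `P` through the coordinates 2 and 3 of `u` and `v`.
  have key2 : α 0 u * α 1 v - α 0 v * α 1 u = 0 := by
    obtain ⟨ρ, hρ, h⟩ := exists_five
    obtain ⟨Φ, hΦ, hΦℓ, hΦm⟩ := hrep.exists_mem hspan (by decide) ρ hρ
    have e1 := entry_eq hspan Φ (α 0) 0 4 fun g => by rw [hΦℓ, hα, (h _).1]
    have e2 := entry_eq hspan Φ (α 1) 4 3 fun g => by rw [hΦℓ, hα, (h _).2.1]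
    have e3 := entry_eq hspan Φ (α 2) 0 1 fun g => by rw [hΦℓ, hα, (h _).2.2.1]
    have e4 := entry_eq hspan Φ (α 3) 2 3 fun g => by rw [hΦℓ, hα, (h _).2.2.2]
    have h3 := (lie_apply_five (hΦm u) (hΦm v)).1
    rw [← hΦ, huv, map_zero, e1, e1, e2, e2, e3, e3, e4, e4, Matrix.zero_apply] at h3
    have m02 := key 0 2 (by decide) (by decide)
    have m03 := key 0 3 (by decide) (by decide)
    have m12 := key 1 2 (by decide) (by decide)
    have m13 := key 1 3 (by decide) (by decide)
    set P := α 0 u * α 1 v - α 0 v * α 1 u with hP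
    -- Expansion of a 3 × 3 determinant with a repeated row: `P` times a coordinate 2 or 3 is a
    -- combination of minors already known to vanish.
    have p2u : P * α 2 u = 0 := by rw [hP]; linear_combination α 1 u * m02 - α 0 u * m12
    have p2v : P * α 2 v = 0 := by rw [hP]; linear_combination α 1 v * m02 - α 0 v * m12
    have p3u : P * α 3 u = 0 := by rw [hP]; linear_combination α 1 u * m03 - α 0 u * m13
    have p3v : P * α 3 v = 0 := by rw [hP]; linear_combination α 1 v * m03 - α 0 v * m13
    have : P * P = 0 := by
      have e : P = α 2 v * Φ u 1 3 + Φ v 0 2 * α 3 u - α 2 u * Φ v 1 3 - Φ u 0 2 * α 3 v := by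
        rw [hP]; linear_combination -h3
      linear_combination P * e + Φ u 1 3 * p2v + Φ v 0 2 * p3u - Φ v 1 3 * p2u - Φ u 0 2 * p3v
    exact mul_self_eq_zero.1 this
  by_cases h : p = 0 ∧ q = 1
  · rw [h.1, h.2]; exact key2
  by_cases h' : p = 1 ∧ q = 0
  · rw [h'.1, h'.2]; linear_combination -key2
  · exact key p q h h'

/-- A formulation free of coordinates, so that it can be transported along a Lie isomorphism. -/
lemma functional_minor_eq_zero (hrep : ExtendsRepresentations ℓ) (hℓ : IsLieLog ℓ)
    (hH : ∀ a b c d : exampleH, gcomm (gcomm (gcomm a b) c) d = 1) {u v : M} (huv : ⁅u, v⁆ = 0)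
    (μ ν : M →ₗ[ℚ] ℚ) (hμ : ∀ x y : M, μ ⁅x, y⁆ = 0) (hν : ∀ x y : M, ν ⁅x, y⁆ = 0) :
    μ u * ν v - μ v * ν u = 0 := by
  choose α hα using hrep.exists_coord
  -- A functional killing brackets is a group homomorphism on logarithms, hence determined by the
  -- generators of `H`; so it is a combination of the `α i`, and all minors reduce to those of the
  -- `α i`.
  have key : ∀ μ : M →ₗ[ℚ] ℚ, (∀ x y : M, μ ⁅x, y⁆ = 0) →
      ∀ x, μ x = ∑ i, α i x * μ (ℓ (genH i)) := by
    intro μ hμ x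
    let f : exampleH →* Multiplicative ℚ :=
      { toFun := fun g => Multiplicative.ofAdd (μ (ℓ g))
        map_one' := by rw [hℓ.one, map_zero]; rfl
        map_mul' := fun g h => congrArg Multiplicative.ofAdd (hℓ.linearMap_mul hH μ hμ g h) }
    let f' : exampleH →* Multiplicative ℚ :=
      { toFun := fun g => Multiplicative.ofAdd
          (∑ i, coord i (g : ExampleGroup).toNil * μ (ℓ (genH i)))
        map_one' := by
          simp only [Subgroup.coe_one, ExampleGroup.toNil_one, map_zero, zero_mul,
            Finset.sum_const_zero]
          rfl
        map_mul' := fun g h => by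
          simp only [Subgroup.coe_mul, ExampleGroup.coord_mul, add_mul, Finset.sum_add_distrib]
          rfl }
    have hff' : f = f' := by
      refine MonoidHom.eq_of_eqOn_dense closure_genH ?_
      rintro _ ⟨j, rfl⟩
      refine congrArg Multiplicative.ofAdd ?_
      simp [toNil_genH, coord_genN]
    have : μ = ∑ i, μ (ℓ (genH i)) • α i := by
      refine LinearMap.ext_on_range hℓ.span fun g => ?_
      have h1 : μ (ℓ g) = ∑ i, coord i (g : ExampleGroup).toNil * μ (ℓ (genH i)) :=
        congrArg Multiplicative.toAdd (DFunLike.congr_fun hff' g)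
      rw [h1]
      simp [hα, mul_comm]
    conv_lhs => rw [this]
    simp [mul_comm]
  rw [key μ hμ u, key μ hμ v, key ν hν u, key ν hν v, Finset.sum_mul_sum, Finset.sum_mul_sum,
    ← Finset.sum_sub_distrib]
  refine Finset.sum_eq_zero fun i _ => ?_
  rw [← Finset.sum_sub_distrib]
  refine Finset.sum_eq_zero fun j _ => ?_
  linear_combination μ (ℓ (genH i)) * ν (ℓ (genH j)) *
    coord_minor_eq_zero hrep hℓ.span α hα huv i j

end Detecting

end MagnusLie

namespace MagnusLie

/-! ### Coordinates on the graded Lie algebra, where the first two generators commute. -/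

section Graded

open scoped TensorProduct commutatorElement

/-- Elements of `τ_2` have a power in `γ_2`, where the coordinates vanish, and `ℚ` is torsion-free.
Thus coordinates descend to every graded piece, being nonzero only in degree one. -/
lemma coordHom_eq_one_of_mem (p : Fin 4) {i : ℕ+} {x : exampleH} (hx : x ∈ tau exampleH (i + 1)) :
    coordHom p x = 1 := by
  obtain ⟨n, hn, hxn⟩ := tau_anti (show (2 : ℕ+) ≤ i + 1 from by
    rw [← PNat.coe_le_coe, PNat.add_coe]; have := i.pos; change 2 ≤ (i : ℕ) + 1; omega) hx
  have h1 : coord p ((x : ExampleGroup) ^ n).toNil = 0 :=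
    coord_eq_zero_of_mem p (exampleH_lowerCentralSeries_le 1 hxn)
  rw [ExampleGroup.toNil_pow, map_smul, smul_eq_zero] at h1
  exact h1.resolve_left (by exact_mod_cast hn)

/-- The coordinate map on `τ_i(H) / τ_{i+1}(H)`. -/
noncomputable def grCoord (p : Fin 4) (i : ℕ+) : GrPiece exampleH i →+ ℚ :=
  MonoidHom.toAdditiveLeft (QuotientGroup.lift _ ((coordHom p).comp (tau exampleH i).subtype)
    fun _ hx => coordHom_eq_one_of_mem p hx)

/-- The coordinate map on `L(H)`. -/
noncomputable def gradedCoord (p : Fin 4) : GradedLie exampleH →+ ℚ :=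
  DirectSum.toAddMonoid (grCoord p)

lemma gradedCoord_homog (p : Fin 4) {i : ℕ+} {x : exampleH} (hx : x ∈ tau exampleH i) :
    gradedCoord p (GradedLie.homog i x hx) = (coordHom p x).toAdd :=
  DirectSum.toAddMonoid_of (grCoord p) i _

lemma gradedCoord_lie (p : Fin 4) (x y : GradedLie exampleH) : gradedCoord p ⁅x, y⁆ = 0 := by
  induction x using GradedLie.ind with
  | h0 => rw [zero_lie, map_zero]
  | h2 x x' h h' => rw [add_lie, map_add, h, h', add_zero]
  | h1 i a ha =>
    induction y using GradedLie.ind with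
    | h0 => rw [lie_zero, map_zero]
    | h2 y y' h h' => rw [lie_add, map_add, h, h', add_zero]
    | h1 j b hb =>
      rw [GradedLie.bracket_homog, gradedCoord_homog]
      simp only [gcomm, map_mul, map_inv]
      rw [mul_assoc, mul_comm (coordHom p a)⁻¹, mul_assoc, inv_mul_cancel_left,
        inv_mul_cancel, toAdd_one]

/-- The coordinate map on `ℚ ⊗ L(H)`. -/
noncomputable def gradedAlgebraCoord (p : Fin 4) : GradedLieAlgebra ℚ exampleH →ₗ[ℚ] ℚ :=
  LinearMap.liftBaseChange ℚ (gradedCoord p).toIntLinearMap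

lemma gradedAlgebraCoord_tmul (p : Fin 4) (a : ℚ) (x : GradedLie exampleH) :
    gradedAlgebraCoord p (a ⊗ₜ x) = a * gradedCoord p x := by
  simp [gradedAlgebraCoord]

lemma gradedAlgebraCoord_lie (p : Fin 4) (x y : GradedLieAlgebra ℚ exampleH) :
    gradedAlgebraCoord p ⁅x, y⁆ = 0 := by
  induction x using TensorProduct.induction_on with
  | zero => rw [zero_lie, map_zero]
  | add x x' h h' => rw [add_lie, map_add, h, h', add_zero]
  | tmul a x =>
    generalize hz : (a ⊗ₜ x : GradedLieAlgebra ℚ exampleH) = z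
    induction y using TensorProduct.induction_on with
    | zero => exact (congrArg _ (lie_zero (L := GradedLieAlgebra ℚ exampleH) z)).trans (map_zero _)
    | add x x' h h' =>
      refine (congrArg _ (lie_add (L := GradedLieAlgebra ℚ exampleH) z x x')).trans ?_
      rw [map_add, h, h', add_zero]
    | tmul b y =>
      rw [← hz, LieAlgebra.ExtendScalars.bracket_tmul, gradedAlgebraCoord_tmul, gradedCoord_lie, mul_zero]

lemma genH_mem_tau (i : Fin 4) : genH i ∈ tau exampleH 1 :=
  ⟨1, one_ne_zero, Subgroup.mem_top _⟩

/-- The class of `y_{i+1}` in `ℚ ⊗ L(H)`. -/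
noncomputable def gradedGen (i : Fin 4) : GradedLieAlgebra ℚ exampleH :=
  1 ⊗ₜ GradedLie.homog 1 (genH i) (genH_mem_tau i)

lemma gradedAlgebraCoord_gradedGen (p i : Fin 4) :
    gradedAlgebraCoord p (gradedGen i) = if i = p then 1 else 0 := by
  rw [gradedGen, gradedAlgebraCoord_tmul, gradedCoord_homog, coordHom_genH, one_mul, toAdd_ofAdd]

/-- The bracket is the class of the group commutator in `τ_2 / τ_3`, and that commutator lies in
`γ_3`. -/
lemma gradedGen_lie : ⁅gradedGen 0, gradedGen 1⁆ = 0 := by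
  have h1 : gcomm (genH 0) (genH 1) ∈ tau exampleH (1 + 1 + 1) := by
    refine ⟨1, one_ne_zero, ?_⟩
    have e : gcomm (genH 0) (genH 1) =
        (genH 1 * genH 0)⁻¹ * ⁅genH 0, genH 1⁆ * (genH 1 * genH 0)⁻¹⁻¹ := by
      simp [gcomm, commutatorElement_def, mul_assoc]
    rw [pow_one, e]
    exact (gamma_normal (1 + 1 + 1)).conj_mem _ commutator_genH_mem _
  rw [gradedGen, gradedGen, LieAlgebra.ExtendScalars.bracket_tmul, GradedLie.bracket_homog,
    ← GradedLie.homog_eq (one_mem _) _ (by simpa using h1), GradedLie.homog_one,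
    TensorProduct.tmul_zero]

end Graded

/-! ### The absence of an isomorphism and the conclusion. -/

section Main

open scoped commutatorElement

lemma exampleH_class (a b c d : exampleH) : gcomm (gcomm (gcomm a b) c) d = 1 := by
  have h : ∀ k, ∀ x ∈ (⊤ : Subgroup exampleH).lowerCentralSeries k, ∀ y : exampleH,
      gcomm x y ∈ (⊤ : Subgroup exampleH).lowerCentralSeries (k + 1) := fun k x hx y => by
    rw [gcomm_eq]
    exact Subgroup.commutator_mem_commutator (inv_mem hx) (Subgroup.mem_top _)
  have h3 := h 2 _ (h 1 _ (h 0 a (Subgroup.mem_top _) b) c) d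
  rw [exampleH_lowerCentralSeries_three] at h3
  exact Subgroup.mem_bot.1 h3

set_option synthInstance.maxHeartbeats 400000 in
lemma extendsRepresentations_logLie : ExtendsRepresentations (M := logLie exampleH_class)
    fun g => ⟨groupLog ℚ g, groupLog_mem_logSpan g⟩ := by
  intro n d hd ρ hρ
  obtain ⟨Φ, h1, h2⟩ := exists_completion_representation hd ρ hρ
  exact ⟨Φ.comp (logLie exampleH_class).toSubmodule.subtype, fun x y => h1 x y, h2⟩

/-- An isomorphism would pull the first two graded generators and their coordinate functionals back
to commuting elements with minor 1, against `functional_minor_eq_zero`. -/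
lemma not_lieEquiv_gradedLieAlgebra {M : Type*} [LieRing M] [LieAlgebra ℚ M] {ℓ : exampleH → M}
    (hℓ : IsLieLog ℓ) (hrep : ExtendsRepresentations ℓ) :
    IsEmpty (M ≃ₗ⁅ℚ⁆ GradedLieAlgebra ℚ exampleH) := by
  refine ⟨fun e => ?_⟩
  have huv : ⁅e.symm (gradedGen 0), e.symm (gradedGen 1)⁆ = 0 := by
    rw [← LieEquiv.map_lie, gradedGen_lie, map_zero]
  have h := functional_minor_eq_zero hrep hℓ exampleH_class huv
    ((gradedAlgebraCoord 0).comp (e : M →ₗ[ℚ] GradedLieAlgebra ℚ exampleH))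
    ((gradedAlgebraCoord 1).comp (e : M →ₗ[ℚ] GradedLieAlgebra ℚ exampleH))
    (fun x y => (congrArg _ (e.map_lie x y)).trans (gradedAlgebraCoord_lie 0 _ _))
    (fun x y => (congrArg _ (e.map_lie x y)).trans (gradedAlgebraCoord_lie 1 _ _))
  have e0 : ∀ p i, ((gradedAlgebraCoord p).comp (e : M →ₗ[ℚ] GradedLieAlgebra ℚ exampleH))
      (e.symm (gradedGen i)) = if i = p then 1 else 0 := by
    intro p i
    rw [← gradedAlgebraCoord_gradedGen]
    exact congrArg _ (e.apply_symm_apply _)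
  rw [e0, e0, e0, e0] at h
  norm_num at h

instance : Group.FG exampleH := by
  rw [Group.fg_iff]
  exact ⟨Set.range genH, closure_genH, Set.finite_range _⟩

end Main

end MagnusLie

theorem mainTheorem6 :
    Group.FG MagnusLie.exampleH ∧ Group.IsNilpotent MagnusLie.exampleH ∧
    MagnusLie.IsMagnus MagnusLie.exampleH ∧ ¬ MagnusLie.IsRelativelyFree MagnusLie.exampleH ∧
    ∃ 𝔏 : LieSubalgebra ℚ (MagnusLie.completion ℚ MagnusLie.exampleH),
      𝔏.toSubmodule = MagnusLie.logSpan ℚ MagnusLie.exampleH ∧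
      IsEmpty (𝔏 ≃ₗ⁅ℚ⁆ MagnusLie.GradedLieAlgebra ℚ MagnusLie.exampleH) := by
  refine ⟨inferInstance, ?_, MagnusLie.exampleH_isMagnus,
    MagnusLie.exampleH_not_isRelativelyFree, MagnusLie.logLie MagnusLie.exampleH_class, rfl,
    MagnusLie.not_lieEquiv_gradedLieAlgebra (MagnusLie.isLieLog_logLie MagnusLie.exampleH_class)
      MagnusLie.extendsRepresentations_logLie⟩
  exact Subgroup.nilpotent_iff_lowerCentralSeries.2
    ⟨3, MagnusLie.exampleH_lowerCentralSeries_three⟩
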